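/- Let $\mathbb F$ be a field. For an $\mathbb F$-vector space $V$ put $\mathsf\Gamma(V)=\bigoplus_{n\ge 1}(V^{\otimes n})^{S(n)}$, with the evident action $\mathsf\Gamma(f)=\bigoplus_n f^{\otimes n}$ on linear maps. For $v_1,\dots,v_n\in V$ and integers $r_1,\dots,r_n\ge 0$, not all zero, the divided power monomial is $$v_1^{[r_1]}*\cdots*v_n^{[r_n]}=\sum_{\sigma\in S(r_1+\cdots+r_n)/(S(r_1)\times\cdots\times S(r_n))}\sigma\bigl(v_1^{\otimes r_1}\otimes\cdots\otimes v_n^{\otimes r_n}\bigr)\in\mathsf\Gamma(V),$$ so that factors with exponent $0$ are omitted. **(1)** There are unique linear maps $\mu_V:\mathsf\Gamma(\mathsf\Gamma(V))\to\mathsf\Gamma(V)$, $\partial_V:\mathsf\Gamma(V)\to\mathsf\Gamma(V\times V)$ and $\varepsilon_V:\mathsf\Gamma(V)\to V$ such that, for all vectors and all integers $n,p,k_i,q_{i,j},r_i\ge1$, $$\mu_V\Bigl(\bigl(v_{1,1}^{[q_{1,1}]}*\cdots*v_{1,k_1}^{[q_{1,k_1}]}\bigr)^{[r_1]}*\cdots*\bigl(v_{p,1}^{[q_{p,1}]}*\cdots*v_{p,k_p}^{[q_{p,k_p}]}\bigr)^{[r_p]}\Bigr)=\Bigl(\prod_{i=1}^p\frac1{r_i!}\prod_{j=1}^{k_i}\frac{(r_iq_{i,j})!}{(q_{i,j}!)^{r_i}}\Bigr)\,v_{1,1}^{[r_1q_{1,1}]}*\cdots*v_{1,k_1}^{[r_1q_{1,k_1}]}*\cdots*v_{p,k_p}^{[r_pq_{p,k_p}]}$$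 (the coefficient is an integer), $$\partial_V\bigl(v_1^{[r_1]}*\cdots*v_n^{[r_n]}\bigr)=\sum_{i=1}^n(v_1,0)^{[r_1]}*\cdots*(v_i,0)^{[r_i-1]}*\cdots*(v_n,0)^{[r_n]}*(0,v_i)^{[1]},$$ and $\varepsilon_V(v^{[1]})=v$, while $\varepsilon_V$ vanishes on all other divided power monomials with positive exponents. Put $\eta_V(v)=v^{[1]}$. **(2)** $(\mathsf\Gamma,\mu,\eta)$ is a monad on the category $\mathbb F\text{-}\mathsf{VEC}$ of $\mathbb F$-vector spaces. Regard it as a comonad $({!},\delta,\epsilon)$ on $\mathbb X=\mathbb F\text{-}\mathsf{VEC}^{op}$, where ${!}=\mathsf\Gamma$, $\delta=\mu$, $\epsilon=\eta$, and the product $A\times B$ in $\mathbb X$ is the vector space product, with projections $\pi_0,\pi_1$ the (opposites of the) two inclusions. Then $\partial_A:{!}(A\times A)\to{!} A$ is a differential combinator transformation, so that $(\mathsf\Gamma,\mu,\eta,\partial)$ is a Cartesian differential comonad on $\mathbb X$: $\partial$ is natural and, with $\iota_0=\langle1,0\rangle$, $\iota_1=\langle0,1\rangle$, $\nabla=\pi_0+\pi_1$,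 $\ell=\iota_0\times\iota_1$, $c=\langle\pi_0\times\pi_0,\pi_1\times\pi_1\rangle$, it satisfies in $\mathbb X$ $$\partial_A\circ{!}(\iota_0)=0,\qquad \partial_A\circ{!}(1\times\nabla)=\partial_A\circ({!}(1\times\pi_0)+{!}(1\times\pi_1)),\qquad \epsilon_A\circ\partial_A=\pi_1\circ\epsilon_{A\times A},$$ $$\delta_A\circ\partial_A=\partial_{{!} A}\circ{!}\langle{!}(\pi_0),\partial_A\rangle\circ\delta_{A\times A},\qquad \partial_A\circ\partial_{A\times A}\circ{!}(\ell)=\partial_A,\qquad \partial_A\circ\partial_{A\times A}\circ{!}(c)=\partial_A\circ\partial_{A\times A}.$$ **(3)** $\varepsilon$, regarded as a family of maps $\varepsilon_A:A\to{!} A$ in $\mathbb X$, is a $\mathsf D$-linear unit: it is natural, $\epsilon_A\circ\varepsilon_A=1_A$ and $\varepsilon_A\circ\epsilon_A=\partial_A\circ{!}(\iota_1)$. **(4)** Consequently the coKleisli category $\mathbb X_{\mathsf\Gamma}=\mathbb F\text{-}\mathsf{VEC}^{op}_{\mathsf\Gamma}$, with the products, sums and zero maps inherited from $\mathbb X$,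 is a Cartesian differential category with differential combinator $\mathsf D[f]=f\circ\partial_A$ (composition in $\mathbb X$) for $f:{!} A\to B$; that is, $\mathsf D$ satisfies in $\mathbb X_{\mathsf\Gamma}$ the axioms: $\mathsf D[f+g]=\mathsf D[f]+\mathsf D[g]$, $\mathsf D[0]=0$; $\mathsf D[f]\circ(1\times\nabla)=\mathsf D[f]\circ(1\times\pi_0)+\mathsf D[f]\circ(1\times\pi_1)$, $\mathsf D[f]\circ\iota_0=0$; $\mathsf D[1]=\pi_1$, $\mathsf D[\pi_j]=\pi_j\circ\pi_1$; $\mathsf D[\langle f,g\rangle]=\langle\mathsf D[f],\mathsf D[g]\rangle$; $\mathsf D[g\circ f]=\mathsf D[g]\circ\langle f\circ\pi_0,\mathsf D[f]\rangle$; $\mathsf D[\mathsf D[f]]\circ\ell=\mathsf D[f]$; $\mathsf D[\mathsf D[f]]\circ c=\mathsf D[\mathsf D[f]]$. **(5)** Let $\mathsf D\text{-}\mathsf{lin}[\mathbb X_{\mathsf\Gamma}]$ be the subcategory of $\mathbb X_{\mathsf\Gamma}$ with all objects and with the maps $f$ such that $\mathsf D[f]=f\circ\pi_1$ in $\mathbb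 X_{\mathsf\Gamma}$. The functor $\mathbb F\text{-}\mathsf{VEC}^{op}\to\mathsf D\text{-}\mathsf{lin}[\mathbb X_{\mathsf\Gamma}]$ that is the identity on objects and sends $f:A\to B$ to $f\circ\epsilon_A$ is well defined and an isomorphism of categories, so $\mathsf D\text{-}\mathsf{lin}[\mathbb F\text{-}\mathsf{VEC}^{op}_{\mathsf\Gamma}]\cong\mathbb F\text{-}\mathsf{VEC}^{op}$. -/

import Mathlib

open CategoryTheory MonoidalCategory CartesianMonoidalCategory
open scoped TensorProduct Nat

universe v u

/-! ## Cartesian left additive and Cartesian differential categories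

Finite products are *chosen* finite products, i.e. `CartesianMonoidalCategory`: `A ⊗ B` is the
chosen product `A × B`, with projections `fst`, `snd`, pairing `lift f g`, and `f ⊗ₘ g` is `f × g`;
`𝟙_ C` is the chosen terminal object. Composition `f ≫ g` is in diagrammatic order. -/

/-- A left additive category: every hom-set is a commutative monoid and precomposition is
additive (no condition on postcomposition). -/
class LeftAdditiveCategory (C : Type u) [Category.{v} C] where
  homAddCommMonoid : ∀ A B : C, AddCommMonoid (A ⟶ B)
  comp_add : ∀ {A' A B : C} (x : A' ⟶ A) (f g : A ⟶ B), x ≫ (f + g) = x ≫ f + x ≫ g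
  comp_zero : ∀ {A' A : C} (x : A' ⟶ A) (B : C), x ≫ (0 : A ⟶ B) = 0

attribute [reducible, instance] LeftAdditiveCategory.homAddCommMonoid

/-- A map is additive if postcomposition with it preserves sums and zeros. -/
def IsAdditiveMap {C : Type u} [Category.{v} C] [LeftAdditiveCategory C] {A B : C}
    (f : A ⟶ B) : Prop :=
  ∀ (A' : C), (∀ x y : A' ⟶ A, (x + y) ≫ f = x ≫ f + y ≫ f) ∧ (0 : A' ⟶ A) ≫ f = 0

/-- A Cartesian left additive category: left additive, with (chosen) finite products whose
projections are additive. -/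
class CartesianLeftAdditiveCategory (C : Type u) [Category.{v} C] [CartesianMonoidalCategory C]
    extends LeftAdditiveCategory C where
  fst_additive : ∀ A B : C, IsAdditiveMap (fst A B)
  snd_additive : ∀ A B : C, IsAdditiveMap (snd A B)

section StructureMaps

variable {C : Type u} [Category.{v} C] [CartesianMonoidalCategory C]
  [∀ A B : C, AddCommMonoid (A ⟶ B)]

/-- The injection `ι₀ = ⟨1, 0⟩ : A ⟶ A × B`. -/
def inj₀ (A B : C) : A ⟶ A ⊗ B := lift (𝟙 A) 0

/-- The injection `ι₁ = ⟨0, 1⟩ : B ⟶ A × B`. -/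
def inj₁ (A B : C) : B ⟶ A ⊗ B := lift 0 (𝟙 B)

/-- The sum map `∇ = π₀ + π₁ : A × A ⟶ A`. -/
def sumMap (A : C) : A ⊗ A ⟶ A := fst A A + snd A A

/-- The lifting map `ℓ = ι₀ × ι₁ : A × A ⟶ (A × A) × (A × A)`. -/
def liftingMap (A : C) : A ⊗ A ⟶ (A ⊗ A) ⊗ (A ⊗ A) := inj₀ A A ⊗ₘ inj₁ A A

/-- The interchange map `c = ⟨π₀ × π₀, π₁ × π₁⟩ : (A × A) × (A × A) ⟶ (A × A) × (A × A)`. -/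
def interchangeMap (A : C) : (A ⊗ A) ⊗ (A ⊗ A) ⟶ (A ⊗ A) ⊗ (A ⊗ A) :=
  lift (fst A A ⊗ₘ fst A A) (snd A A ⊗ₘ snd A A)

end StructureMaps

/-- A differential combinator on a Cartesian left additive category. A Cartesian differential
category is a Cartesian left additive category equipped with one. -/
structure DifferentialCombinator (C : Type u) [Category.{v} C] [CartesianMonoidalCategory C]
    [CartesianLeftAdditiveCategory C] where
  /-- the derivative `D[f] : A × A ⟶ B` of `f : A ⟶ B` -/
  D : ∀ {A B : C}, (A ⟶ B) → (A ⊗ A ⟶ B)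
  D_add : ∀ {A B : C} (f g : A ⟶ B), D (f + g) = D f + D g
  D_zero : ∀ A B : C, D (0 : A ⟶ B) = 0
  D_sumMap : ∀ {A B : C} (f : A ⟶ B),
    (𝟙 A ⊗ₘ sumMap A) ≫ D f = (𝟙 A ⊗ₘ fst A A) ≫ D f + (𝟙 A ⊗ₘ snd A A) ≫ D f
  D_inj₀ : ∀ {A B : C} (f : A ⟶ B), inj₀ A A ≫ D f = 0
  D_id : ∀ A : C, D (𝟙 A) = snd A A
  D_fst : ∀ A B : C, D (fst A B) = snd (A ⊗ B) (A ⊗ B) ≫ fst A B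
  D_snd : ∀ A B : C, D (snd A B) = snd (A ⊗ B) (A ⊗ B) ≫ snd A B
  D_lift : ∀ {X A B : C} (f : X ⟶ A) (g : X ⟶ B), D (lift f g) = lift (D f) (D g)
  D_comp : ∀ {A B X : C} (f : A ⟶ B) (g : B ⟶ X), D (f ≫ g) = lift (fst A A ≫ f) (D f) ≫ D g
  D_lifting : ∀ {A B : C} (f : A ⟶ B), liftingMap A ≫ D (D f) = D f
  D_interchange : ∀ {A B : C} (f : A ⟶ B), interchangeMap A ≫ D (D f) = D (D f)

namespace DifferentialCombinator

variable {C : Type u} [Category.{v} C] [CartesianMonoidalCategory C]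
  [CartesianLeftAdditiveCategory C] (𝔇 : DifferentialCombinator C)

/-- `f` is `D`-linear if `D[f] = f ∘ π₁`. -/
def IsLinear : MorphismProperty C := fun A _ f => 𝔇.D f = snd A A ≫ f

instance : 𝔇.IsLinear.IsMultiplicative where
  id_mem A := by simp [IsLinear, 𝔇.D_id]
  comp_mem f g hf hg := by
    simp only [IsLinear] at hf hg ⊢
    rw [𝔇.D_comp, hg, lift_snd_assoc, hf, Category.assoc]

/-- The subcategory `D-lin[C]` of `D`-linear maps: all objects, and the `D`-linear maps. -/
abbrev DLin : Type u := WideSubcategory 𝔇.IsLinear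

end DifferentialCombinator

/-! ## Cartesian differential comonads

A category with finite biproducts is given as a preadditive category with chosen finite
products. -/

theorem cokleisli_comp_base {C : Type u} [Category.{v} C] (U : Comonad C) {X P Q : C}
    (x : U.obj X ⟶ P) (g : P ⟶ Q) : U.δ.app X ≫ U.map x ≫ U.ε.app P ≫ g = x ≫ g := by
  simp

section Comonads

variable {C : Type u} [Category.{v} C] [Preadditive C] [CartesianMonoidalCategory C]

/-- A differential combinator transformation on a comonad `U = (!, δ, ε)`. A Cartesian
differential comonad is a comonad together with such a transformation. -/
structure DifferentialCombinatorTransformation (U : Comonad C) where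
  app : ∀ A : C, U.obj (A ⊗ A) ⟶ U.obj A
  naturality : ∀ {A B : C} (f : A ⟶ B), U.map (f ⊗ₘ f) ≫ app B = app A ≫ U.map f
  zero_rule : ∀ A : C, U.map (inj₀ A A) ≫ app A = 0
  additive_rule : ∀ A : C, U.map (𝟙 A ⊗ₘ sumMap A) ≫ app A =
    (U.map (𝟙 A ⊗ₘ fst A A) + U.map (𝟙 A ⊗ₘ snd A A)) ≫ app A
  linear_rule : ∀ A : C, app A ≫ U.ε.app A = U.ε.app (A ⊗ A) ≫ snd A A
  chain_rule : ∀ A : C, app A ≫ U.δ.app A =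
    U.δ.app (A ⊗ A) ≫ U.map (lift (U.map (fst A A)) (app A)) ≫ app (U.obj A)
  lift_rule : ∀ A : C, U.map (liftingMap A) ≫ app (A ⊗ A) ≫ app A = app A
  symmetry_rule : ∀ A : C,
    U.map (interchangeMap A) ≫ app (A ⊗ A) ≫ app A = app (A ⊗ A) ≫ app A

/-- A `D`-linear unit of a Cartesian differential comonad. -/
structure DLinearUnit {U : Comonad C} (d : DifferentialCombinatorTransformation U) where
  app : ∀ A : C, A ⟶ U.obj A
  naturality : ∀ {A B : C} (f : A ⟶ B), f ≫ app B = app A ≫ U.map f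
  linear_rule : ∀ A : C, app A ≫ U.ε.app A = 𝟙 A
  linearization_rule : ∀ A : C, U.ε.app A ≫ app A = U.map (inj₁ A A) ≫ d.app A

/-! ### The Cartesian left additive structure of the coKleisli category -/

variable (U : Comonad C)

/-- The chosen finite products of the coKleisli category: objects as in the base, projections
`π_j ∘ ε`, pairing as in the base. -/
instance cokleisliCartesian : CartesianMonoidalCategory (Cokleisli U) :=
  .ofChosenFiniteProducts
    ⟨Limits.asEmptyCone (Cokleisli.mk U (𝟙_ C)), Limits.IsTerminal.ofUniqueHom
      (fun A => ⟨toUnit (U.obj A.of)⟩)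
      (fun _ _ => Cokleisli.hom_ext U (toUnit_unique _ _))⟩
    (fun A B =>
      ⟨Limits.BinaryFan.mk (P := Cokleisli.mk U (A.of ⊗ B.of))
          ⟨U.ε.app (A.of ⊗ B.of) ≫ fst A.of B.of⟩ ⟨U.ε.app (A.of ⊗ B.of) ≫ snd A.of B.of⟩,
        Limits.BinaryFan.IsLimit.mk _ (fun f g => ⟨lift f.of g.of⟩)
          (fun f g => Cokleisli.hom_ext U (by simp))
          (fun f g => Cokleisli.hom_ext U (by simp))
          (fun f g m hf hg => Cokleisli.hom_ext U (by
            subst hf hg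
            apply CartesianMonoidalCategory.hom_ext <;> simp))⟩)

/-- CoKleisli maps `A ⟶ B` are maps `!A ⟶ B` of the base category. -/
def cokleisliHomEquiv (A B : Cokleisli U) : (A ⟶ B) ≃ (U.obj A.of ⟶ B.of) where
  toFun f := f.of
  invFun f := ⟨f⟩
  left_inv _ := rfl
  right_inv _ := rfl

/-- The sum and zero of coKleisli maps are those of the base category. -/
instance cokleisliHomAdd (A B : Cokleisli U) : AddCommMonoid (A ⟶ B) :=
  (cokleisliHomEquiv U A B).addCommMonoid

instance cokleisliLeftAdditive : CartesianLeftAdditiveCategory (Cokleisli U) where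
  homAddCommMonoid A B := cokleisliHomAdd U A B
  comp_add x f g := Cokleisli.hom_ext U (by
    change _ ≫ _ ≫ (f.of + g.of) = _ ≫ _ ≫ f.of + _ ≫ _ ≫ g.of
    simp)
  comp_zero x B := Cokleisli.hom_ext U (by
    change _ ≫ _ ≫ (0 : U.obj _ ⟶ B.of) = 0
    simp)
  fst_additive A B X := by
    refine ⟨fun x y => Cokleisli.hom_ext U ?_, Cokleisli.hom_ext U ?_⟩
    · exact (cokleisli_comp_base U (x.of + y.of) (fst A.of B.of)).trans
        ((Preadditive.add_comp _ _ _ _ _ _).trans (congrArg₂ (· + ·)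
          (cokleisli_comp_base U x.of _).symm (cokleisli_comp_base U y.of _).symm))
    · exact (cokleisli_comp_base U 0 (fst A.of B.of)).trans Limits.zero_comp
  snd_additive A B X := by
    refine ⟨fun x y => Cokleisli.hom_ext U ?_, Cokleisli.hom_ext U ?_⟩
    · exact (cokleisli_comp_base U (x.of + y.of) (snd A.of B.of)).trans
        ((Preadditive.add_comp _ _ _ _ _ _).trans (congrArg₂ (· + ·)
          (cokleisli_comp_base U x.of _).symm (cokleisli_comp_base U y.of _).symm))
    · exact (cokleisli_comp_base U 0 (snd A.of B.of)).trans Limits.zero_comp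

end Comonads

/-! ## Monads and the opposite comonad -/

/-- The monad axioms for a functor with unit `η` and multiplication `μ`. -/
structure IsMonad {C : Type u} [Category.{v} C] {T : C ⥤ C} (η : 𝟭 C ⟶ T) (μ : T ⋙ T ⟶ T) :
    Prop where
  assoc : ∀ X : C, T.map (μ.app X) ≫ μ.app X = μ.app (T.obj X) ≫ μ.app X
  left_unit : ∀ X : C, η.app (T.obj X) ≫ μ.app X = 𝟙 (T.obj X)
  right_unit : ∀ X : C, T.map (η.app X) ≫ μ.app X = 𝟙 (T.obj X)

/-- The monad `(T, μ, η)`, regarded as a comonad on the opposite category. -/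
def IsMonad.opComonad {C : Type u} [Category.{v} C] {T : C ⥤ C} {η : 𝟭 C ⟶ T} {μ : T ⋙ T ⟶ T}
    (h : IsMonad η μ) : Comonad Cᵒᵖ where
  toFunctor := T.op
  ε := { app := fun A => (η.app A.unop).op
         naturality := fun _ _ f => Quiver.Hom.unop_inj (η.naturality f.unop).symm }
  δ := { app := fun A => (μ.app A.unop).op
         naturality := fun _ _ f => Quiver.Hom.unop_inj (μ.naturality f.unop).symm }
  coassoc A := Quiver.Hom.unop_inj (h.assoc A.unop)
  left_counit A := Quiver.Hom.unop_inj (h.left_unit A.unop)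
  right_counit A := Quiver.Hom.unop_inj (h.right_unit A.unop)

/-! ## Chosen finite products in `F-VEC^op`: the biproducts `V × W` of vector spaces -/

noncomputable section

open Opposite

/-- In `F-VEC^op` the chosen product of `V` and `W` is `V × W`, whose projections are (the opposites
of) the two inclusions into `V × W`; the chosen terminal object is the zero space. -/
instance vecOpCartesian (F : Type u) [Field F] :
    CartesianMonoidalCategory (ModuleCat.{u} F)ᵒᵖ :=
  .ofChosenFiniteProducts
    ⟨Limits.asEmptyCone (op (ModuleCat.of F PUnit.{u + 1})), Limits.IsTerminal.ofUniqueHom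
      (fun A => (ModuleCat.ofHom (0 : PUnit.{u + 1} →ₗ[F] A.unop)).op)
      (fun A m => Quiver.Hom.unop_inj (by
        apply ModuleCat.hom_ext
        apply LinearMap.ext
        intro x
        exact (map_zero m.unop.hom : _)))⟩
    (fun V W =>
      ⟨Limits.BinaryFan.mk (P := op (ModuleCat.of F (V.unop × W.unop)))
          (ModuleCat.ofHom (LinearMap.inl F V.unop W.unop)).op
          (ModuleCat.ofHom (LinearMap.inr F V.unop W.unop)).op,
        Limits.BinaryFan.IsLimit.mk _
          (fun f g => (ModuleCat.ofHom (LinearMap.coprod f.unop.hom g.unop.hom)).op)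
          (fun f g => Quiver.Hom.unop_inj (by
            apply ModuleCat.hom_ext
            exact LinearMap.coprod_inl _ _))
          (fun f g => Quiver.Hom.unop_inj (by
            apply ModuleCat.hom_ext
            exact LinearMap.coprod_inr _ _))
          (fun f g m hf hg => Quiver.Hom.unop_inj (by
            subst hf hg
            apply ModuleCat.hom_ext
            apply LinearMap.prod_ext
            · exact (LinearMap.coprod_inl _ _).symm
            · exact (LinearMap.coprod_inr _ _).symm))⟩)

/-! ## Symmetric tensors and divided power monomials -/

/-- `Γ_n(V) = (V^{⊗n})^{S(n)}`: the tensors of length `n` fixed by all permutations of the factors. -/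
def symTensors (F V : Type u) [Field F] [AddCommGroup V] [Module F V] (n : ℕ) :
    Submodule F (⨂[F]^n V) where
  carrier := {t | ∀ σ : Equiv.Perm (Fin n), PiTensorProduct.reindex F (fun _ => V) σ t = t}
  zero_mem' σ := map_zero _
  add_mem' hs ht σ := by rw [map_add, hs σ, ht σ]
  smul_mem' c t ht σ := by rw [map_smul, ht σ]

/-- `Γ(V) = ⨁_{n ≥ 1} Γ_n(V)`. -/
abbrev Gam (F V : Type u) [Field F] [AddCommGroup V] [Module F V] : Type u :=
  DirectSum {n : ℕ // 0 < n} fun n => symTensors F V n.1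

section Monomials

variable {F V W : Type u} [Field F] [AddCommGroup V] [Module F V] [AddCommGroup W] [Module F W]
variable {ι : Type} [Fintype ι] [DecidableEq ι]

/-- The words of length `∑ r_i` in the alphabet `ι` in which each letter `i` occurs exactly `r_i`
times. They are the rearrangements of a single word, whose stabilizer is the Young subgroup
`∏ S(r_i)`, so they correspond to the cosets in `S(∑ r_i) / ∏ S(r_i)`. -/
def words (r : ι → ℕ) : Finset (Fin (∑ i, r i) → ι) :=
  Finset.univ.filter fun w => ∀ i, (Finset.univ.filter fun k => w k = i).card = r i

/-- The symmetric tensor `∑_{σ ∈ S(∑ r_i) / ∏ S(r_i)} σ(⨂_i v_i^{⊗ r_i})`. -/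
def dpTensor (v : ι → V) (r : ι → ℕ) : ⨂[F]^(∑ i, r i) V :=
  ∑ w ∈ words r, PiTensorProduct.tprod F fun k => v (w k)

theorem dpTensor_mem (v : ι → V) (r : ι → ℕ) :
    dpTensor v r ∈ symTensors F V (∑ i, r i) := by
  intro σ
  rw [dpTensor, map_sum]
  refine Finset.sum_bij' (fun w _ => w ∘ σ.symm) (fun w _ => w ∘ σ) ?_ ?_ ?_ ?_ ?_
  · intro w hw
    simp only [words, Finset.mem_filter, Finset.mem_univ, true_and] at hw ⊢
    intro i
    rw [← hw i]
    exact Finset.card_equiv σ.symm (by simp)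
  · intro w hw
    simp only [words, Finset.mem_filter, Finset.mem_univ, true_and] at hw ⊢
    intro i
    rw [← hw i]
    exact Finset.card_equiv σ (by simp)
  · intro w _; ext k; simp
  · intro w _; ext k; simp
  · intro w _
    exact PiTensorProduct.reindex_tprod (R := F) σ _

/-- The divided power monomial `v_1^{[r_1]} * ⋯ * v_n^{[r_n]}` in `Γ(V)`, for a finite family
`v` of vectors and exponents `r` that are not all zero; a factor with exponent `0` is thereby
omitted. (There is no empty monomial in `Γ(V)`; the value `0` when all exponents vanish is a
placeholder.) -/
def dpMonomial (v : ι → V) (r : ι → ℕ) : Gam F V :=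
  if h : 0 < ∑ i, r i then
    DirectSum.of (fun n : {n : ℕ // 0 < n} => symTensors F V n.1) ⟨∑ i, r i, h⟩ ⟨dpTensor v r, dpTensor_mem v r⟩
  else 0

end Monomials

/-! ## The functor `Γ` and the unit -/

section Functor

variable {F V W X : Type u} [Field F] [AddCommGroup V] [Module F V] [AddCommGroup W] [Module F W]
  [AddCommGroup X] [Module F X]

/-- `f^{⊗n}` restricted to symmetric tensors. -/
def symTensorsMap (f : V →ₗ[F] W) (n : ℕ) : symTensors F V n →ₗ[F] symTensors F W n :=
  (PiTensorProduct.map fun _ : Fin n => f).restrict fun t ht σ => by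
    have h := PiTensorProduct.map_reindex (R := F) (fun _ : Fin n => f) σ t
    rw [ht σ] at h
    exact h.symm

/-- `Γ(f) : Γ(V) → Γ(W)`. -/
def gamMap (f : V →ₗ[F] W) : Gam F V →ₗ[F] Gam F W :=
  DirectSum.lmap fun n : {n : ℕ // 0 < n} => symTensorsMap f n.1

theorem gamMap_id : gamMap (LinearMap.id : V →ₗ[F] V) = LinearMap.id := by
  have h : ∀ n, symTensorsMap (LinearMap.id : V →ₗ[F] V) n = LinearMap.id := fun n => by
    ext t
    simp [symTensorsMap, PiTensorProduct.map_id]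
  simp only [gamMap, h]
  exact DirectSum.lmap_id

theorem gamMap_comp (g : W →ₗ[F] X) (f : V →ₗ[F] W) :
    gamMap (g ∘ₗ f) = gamMap g ∘ₗ gamMap f := by
  have h : ∀ n, symTensorsMap (g ∘ₗ f) n = symTensorsMap g n ∘ₗ symTensorsMap f n := fun n => by
    ext t
    simp only [symTensorsMap, PiTensorProduct.map_comp]
    rfl
  simp only [gamMap, h]
  exact DirectSum.lmap_comp _ _

/-- `Γ(f)` acts on monomials by `v_1^{[r_1]} * ⋯ * v_n^{[r_n]} ↦ f(v_1)^{[r_1]} * ⋯ * f(v_n)^{[r_n]}`. -/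
theorem gamMap_dpMonomial {ι : Type} [Fintype ι] [DecidableEq ι] (f : V →ₗ[F] W)
    (v : ι → V) (r : ι → ℕ) :
    gamMap f (dpMonomial v r) = dpMonomial (fun i => f (v i)) r := by
  unfold dpMonomial
  split_ifs with h
  · rw [gamMap, DirectSum.lmap_of]
    congr 1
    apply Subtype.ext
    change PiTensorProduct.map (fun _ => f) (dpTensor v r) = _
    simp [dpTensor, PiTensorProduct.map_tprod]
  · exact map_zero _

/-- The inclusion `V = Γ_1(V) → Γ(V)`. -/
def gamUnit (F V : Type u) [Field F] [AddCommGroup V] [Module F V] : V →ₗ[F] Gam F V :=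
  DirectSum.lof F {n : ℕ // 0 < n} (fun n => symTensors F V n.1) ⟨1, one_pos⟩ ∘ₗ
    LinearMap.codRestrict (symTensors F V 1)
      (PiTensorProduct.subsingletonEquiv (R := F) (s := fun _ : Fin 1 => V) 0).symm.toLinearMap
      (fun v σ => by
        rw [Subsingleton.elim σ (Equiv.refl _), PiTensorProduct.reindex_refl]
        rfl)

/-- The unit is `v ↦ v^{[1]}`. -/
theorem gamUnit_apply (v : V) :
    gamUnit F V v = dpMonomial (fun _ : Fin 1 => v) (fun _ => 1) := by
  have hw : words (fun _ : Fin 1 => 1) = Finset.univ := by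
    ext w
    simp only [words, Finset.mem_filter, Finset.mem_univ, true_and, iff_true]
    intro i
    rw [Finset.filter_true_of_mem fun k _ => Subsingleton.elim _ _]
    simp
  have hT : dpTensor (F := F) (fun _ : Fin 1 => v) (fun _ => 1) =
      PiTensorProduct.tprod F (fun _ : Fin (∑ _ : Fin 1, 1) => v) := by
    rw [dpTensor, hw]
    simp
  have hp : 0 < ∑ _ : Fin 1, 1 := by simp
  rw [dpMonomial, dif_pos hp]
  have key : ∀ (m : ℕ) (hm : 1 = m) (hm' : 0 < m) (t : ⨂[F]^m V) (ht : t ∈ symTensors F V m),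
      t = PiTensorProduct.tprod F (fun _ : Fin m => v) →
      gamUnit F V v =
        DirectSum.of (fun n : {n : ℕ // 0 < n} => symTensors F V n.1) ⟨m, hm'⟩ ⟨t, ht⟩ := by
    rintro m rfl hm' t ht rfl
    rw [gamUnit, LinearMap.comp_apply, DirectSum.lof_eq_of]
    congr 1
    apply Subtype.ext
    exact PiTensorProduct.subsingletonEquiv_symm_apply' (R := F) (0 : Fin 1) v
  exact key _ (by simp) hp _ _ hT

theorem gamUnit_naturality (f : V →ₗ[F] W) :
    gamMap f ∘ₗ gamUnit F V = gamUnit F W ∘ₗ f := by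
  ext v : 1
  simp only [LinearMap.comp_apply]
  rw [gamUnit_apply, gamUnit_apply, gamMap_dpMonomial]

end Functor

/-- The endofunctor `Γ` of `F-VEC`. -/
def gamFunctor (F : Type u) [Field F] : ModuleCat.{u} F ⥤ ModuleCat.{u} F where
  obj V := ModuleCat.of F (Gam F V)
  map f := ModuleCat.ofHom (gamMap f.hom)
  map_id V := by
    apply ModuleCat.hom_ext
    exact gamMap_id
  map_comp f g := by
    apply ModuleCat.hom_ext
    exact gamMap_comp g.hom f.hom

/-- The unit `η_V(v) = v^{[1]}` of `Γ`. -/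
def gamEta (F : Type u) [Field F] : 𝟭 (ModuleCat.{u} F) ⟶ gamFunctor F where
  app V := ModuleCat.ofHom (gamUnit F V)
  naturality V W f := by
    apply ModuleCat.hom_ext
    exact (gamUnit_naturality f.hom).symm

/-! ## The formulas on divided power monomials -/

section Formulas

variable {F V : Type u} [Field F] [AddCommGroup V] [Module F V]

/-- The integer `(1 / r!) ∏_j (r q_j)! / (q_j!)^r`, for a nonempty family `q` of positive integers
and `r ≥ 1`; the division is exact, see `mulCoeff_mul`. -/
def mulCoeff {k : ℕ} (r : ℕ) (q : Fin k → ℕ) : ℕ :=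
  (∏ j, (r * q j)!) / (r ! * ∏ j, (q j)! ^ r)

theorem mulCoeff_mul {k : ℕ} (hk : 0 < k) (r : ℕ) (q : Fin k → ℕ) (hq : ∀ j, 0 < q j) :
    mulCoeff r q * (r ! * ∏ j, (q j)! ^ r) = ∏ j, (r * q j)! := by
  refine Nat.div_mul_cancel ?_
  obtain ⟨k, rfl⟩ : ∃ l, k = l + 1 := ⟨k - 1, by omega⟩
  rw [Fin.prod_univ_succ, Fin.prod_univ_succ, ← mul_assoc]
  have h : ∀ j, r ! * (q j)! ^ r ∣ (r * q j)! := fun j =>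
    ⟨r.uniformBell (q j), by
      rw [← Nat.uniformBell_mul_eq r (hq j).ne']
      ring⟩
  exact mul_dvd_mul (h 0) (Finset.prod_dvd_prod_of_dvd _ _ fun j _ =>
    (Dvd.intro_left _ rfl).trans (h j.succ))

/-- `m : Γ(Γ(V)) → Γ(V)` is given on divided power monomials of divided power monomials by
`(v_{1,1}^{[q_{1,1}]} * ⋯ * v_{1,k_1}^{[q_{1,k_1}]})^{[r_1]} * ⋯
  * (v_{p,1}^{[q_{p,1}]} * ⋯ * v_{p,k_p}^{[q_{p,k_p}]})^{[r_p]}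
  ↦ (∏_i (1 / r_i!) ∏_j (r_i q_{i,j})! / (q_{i,j}!)^{r_i}) •
    v_{1,1}^{[r_1 q_{1,1}]} * ⋯ * v_{1,k_1}^{[r_1 q_{1,k_1}]} * ⋯ * v_{p,k_p}^{[r_p q_{p,k_p}]}`. -/
def IsGamMul (m : Gam F (Gam F V) →ₗ[F] Gam F V) : Prop :=
  ∀ (p : ℕ) (k : Fin p → ℕ) (r : Fin p → ℕ) (v : ∀ i, Fin (k i) → V) (q : ∀ i, Fin (k i) → ℕ),
    0 < p → (∀ i, 0 < k i) → (∀ i, 0 < r i) → (∀ i j, 0 < q i j) →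
    m (dpMonomial (fun i => dpMonomial (v i) (q i)) r) =
      ((∏ i, mulCoeff (r i) (q i) : ℕ) : F) •
        dpMonomial (fun ij : Σ i, Fin (k i) => v ij.1 ij.2) (fun ij => r ij.1 * q ij.1 ij.2)

/-- `d : Γ(V) → Γ(V × V)` differentiates divided power monomials:
`v_1^{[r_1]} * ⋯ * v_n^{[r_n]} ↦
  ∑_i (v_1,0)^{[r_1]} * ⋯ * (v_i,0)^{[r_i - 1]} * ⋯ * (v_n,0)^{[r_n]} * (0,v_i)^{[1]}`,
where the factor `(v_i,0)^{[r_i - 1]}` is omitted if `r_i = 1`. -/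
def IsGamDeriv (d : Gam F V →ₗ[F] Gam F (V × V)) : Prop :=
  ∀ (n : ℕ) (v : Fin n → V) (r : Fin n → ℕ), 0 < n → (∀ i, 0 < r i) →
    d (dpMonomial v r) = ∑ i, dpMonomial
      (Fin.snoc (α := fun _ => V × V) (fun j => (v j, 0)) (0, v i) : Fin (n + 1) → V × V)
      (Fin.snoc (α := fun _ => ℕ) (Function.update r i (r i - 1)) 1 : Fin (n + 1) → ℕ)

/-- `e : Γ(V) → V` sends `v^{[1]}` to `v` and all other divided power monomials to `0`. -/
def IsGamCounit (e : Gam F V →ₗ[F] V) : Prop :=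
  (∀ v : V, e (dpMonomial (fun _ : Fin 1 => v) (fun _ => 1)) = v) ∧
    ∀ (n : ℕ) (v : Fin n → V) (r : Fin n → ℕ), 0 < n → (∀ i, 0 < r i) →
      ¬ (n = 1 ∧ ∀ i, r i = 1) → e (dpMonomial v r) = 0

end Formulas

end

/-!
The commutative shuffle algebra of functions on words has divided powers over any coefficient
ring: with the half shuffle `x ≺ y` (the shuffles whose first letter comes from `x`), the elements
`γ₀(x) = 1` and `γ_{n+1}(x) = x ≺ γ_n(x)` are divided powers of a series `x` without constant
coefficient. Deleting the first letter is a derivation of the shuffle product, and a series is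
determined by its constant coefficient and these derivatives (`WordSeries.ext_shift`). This reduces
the identities for divided powers, including the coefficient in the formula for `μ`
(`WordSeries.dpow_prod_dpow`), to inductions on the exponents.

A linear map `ψ` from `V` to word series without constant coefficient extends to
`gamLift ψ : Γ(V) → WordSeries`, by iterated half shuffles. Divided power monomials
`v₁^{[r₁]} * ⋯ * v_n^{[r_n]}` go to the products `∏ γ_{r_i}(ψ(v_i))` (`gamLift_dpMonomial`). Taking
the functionals on `V` as the alphabet, one obtains an embedding `gamEmb` of `Γ(V)`. Since divided
power monomials span `Γ(V)` (`span_dpMonomial`, from the orbit sums of a basis of the tensor power),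
and those in divided power monomials span `Γ(Γ(V))`, the formulas of the theorem have at most one
solution. For the existence of `μ` and `∂`, a linear map to word series is shown to take
values in the image of `gamEmb` on monomials, hence everywhere. For `μ`, this map is
`gamLift (gamLift ψ)`; for `∂`, it is the coefficient of `ε` in `gamLift (α + ε β)` over the dual
numbers, where `α` and `β` are the restrictions of `ψ` to the two summands of `V × V`. The
linear unit (`gamCounit`) is the projection to degree `1`.

With the resulting characterizations `gamLift ψ ∘ μ = gamLift (gamLift ψ)` (`gamLift_comp_gamMul`)
and `gamLift ψ ∘ ∂ = gamLiftDeriv α β` (`gamLift_comp_gamDeriv`), all the axioms are identities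
between maps to word series. The chain rule compares the coefficient of `ε` in
`gamLift (gamLift (α + ε β))`, computed in two ways. The second derivative is a coefficient
over `R[ε][ε']`; its symmetry is the automorphism exchanging `ε` and `ε'`, and the lift rule is the
homomorphism `ε ↦ ε ε'`.

The statements about the coKleisli category hold for every Cartesian differential comonad: the
structure maps of its products are images of those of the base category, so each axiom of a
differential combinator is an axiom of the comonad composed with a map. With a `D`-linear unit `e`,
and with `c` the counit of the comonad, a `D`-linear map `f` satisfies `f = (f ∘ e) ∘ c`, so
`f ↦ f ∘ e` is inverse to `f ↦ f ∘ c`.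
-/

/-! ### The shuffle algebra of functions on words -/

/-- Functions on the words in the alphabet `I`, i.e. noncommutative formal power series, to be
multiplied by the shuffle product. -/
def WordSeries (I R : Type*) : Type _ := List I → R

namespace WordSeries

variable {I R S : Type*}

/-- The series obtained from `f` by deleting the first letter `a`. For the shuffle product this is a
derivation. -/
def shift (a : I) (f : WordSeries I R) : WordSeries I R := fun w => f (a :: w)

@[ext]
theorem ext_apply {f g : WordSeries I R} (h : ∀ w, f w = g w) : f = g := funext h

@[simp] theorem shift_apply (a : I) (f : WordSeries I R) (w : List I) :
    shift a f w = f (a :: w) := rfl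

/-- A series is determined by its constant coefficient and its shifts. -/
theorem ext_shift {f g : WordSeries I R} (h₀ : f [] = g []) (h : ∀ a, shift a f = shift a g) :
    f = g := by
  ext w
  cases w with
  | nil => exact h₀
  | cons a w => exact congrFun (h a) w

section Ring

variable [CommRing R]

instance : AddCommGroup (WordSeries I R) := inferInstanceAs (AddCommGroup (List I → R))

instance {F : Type*} [CommRing F] [Algebra F R] : Module F (WordSeries I R) :=
  inferInstanceAs (Module F (List I → R))

@[simp] theorem zero_apply (w : List I) : (0 : WordSeries I R) w = 0 := rfl

@[simp] theorem add_apply (f g : WordSeries I R) (w : List I) : (f + g) w = f w + g w := rfl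

@[simp] theorem smul_apply {F : Type*} [CommRing F] [Algebra F R] (c : F) (f : WordSeries I R)
    (w : List I) : (c • f) w = c • f w := rfl

@[simp] theorem shift_add (a : I) (f g : WordSeries I R) :
    shift a (f + g) = shift a f + shift a g := rfl

@[simp] theorem shift_zero (a : I) : shift a (0 : WordSeries I R) = 0 := rfl

@[simp] theorem shift_smul {F : Type*} [CommRing F] [Algebra F R] (a : I) (c : F)
    (f : WordSeries I R) : shift a (c • f) = c • shift a f := rfl

/-- The coefficients of the shuffle product, by recursion on the word. -/
def mulCoeffs : List I → WordSeries I R → WordSeries I R → R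
  | [], f, g => f [] * g []
  | a :: w, f, g => mulCoeffs w (shift a f) g + mulCoeffs w f (shift a g)

instance : Mul (WordSeries I R) := ⟨fun f g w => mulCoeffs w f g⟩

/-- The coefficients of the unit of the shuffle product, namely the empty word. -/
def oneCoeffs : List I → R
  | [] => 1
  | _ :: _ => 0

instance : One (WordSeries I R) := ⟨oneCoeffs⟩

@[simp] theorem mul_nil (f g : WordSeries I R) : (f * g) [] = f [] * g [] := rfl

@[simp] theorem shift_mul (a : I) (f g : WordSeries I R) :
    shift a (f * g) = shift a f * g + f * shift a g := rfl

theorem mul_cons (a : I) (w : List I) (f g : WordSeries I R) :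
    (f * g) (a :: w) = (shift a f * g) w + (f * shift a g) w := rfl

@[simp] theorem one_nil : (1 : WordSeries I R) [] = 1 := rfl

@[simp] theorem shift_one (a : I) : shift a (1 : WordSeries I R) = 0 := rfl

theorem mul_comm' (f g : WordSeries I R) : f * g = g * f := by
  ext w
  induction w generalizing f g with
  | nil => simp [mul_comm]
  | cons a w ih => rw [mul_cons, mul_cons, ih, ih f, add_comm]

theorem zero_mul' (f : WordSeries I R) : 0 * f = 0 := by
  ext w
  induction w generalizing f with
  | nil => simp
  | cons a w ih => simp [mul_cons, ih]

theorem add_mul' (f g h : WordSeries I R) : (f + g) * h = f * h + g * h := by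
  ext w
  induction w generalizing f g h with
  | nil => simp [add_mul]
  | cons a w ih =>
    simp only [mul_cons, shift_add, add_apply, ih]
    abel

theorem one_mul' (f : WordSeries I R) : 1 * f = f := by
  ext w
  induction w generalizing f with
  | nil => simp
  | cons a w ih => simp [mul_cons, ih, zero_mul']

theorem mul_assoc' (f g h : WordSeries I R) : f * g * h = f * (g * h) := by
  ext w
  induction w generalizing f g h with
  | nil => simp [mul_assoc]
  | cons a w ih =>
    have h : ∀ x y z : WordSeries I R, x * (y + z) = x * y + x * z := fun x y z => by
      rw [mul_comm', add_mul', mul_comm' y, mul_comm' z]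
    simp only [mul_cons, shift_mul, add_mul', h, add_apply, ih]
    abel

instance : CommRing (WordSeries I R) where
  mul_comm := mul_comm'
  zero_mul := zero_mul'
  mul_zero f := by rw [mul_comm', zero_mul']
  right_distrib := add_mul'
  left_distrib f g h := by rw [mul_comm', add_mul', mul_comm' g, mul_comm' h]
  one_mul := one_mul'
  mul_one f := by rw [mul_comm', one_mul']
  mul_assoc := mul_assoc'
  zsmul n f := n • f
  zsmul_zero' := zero_zsmul
  zsmul_succ' n f := SubNegMonoid.zsmul_succ' n f
  zsmul_neg' n f := SubNegMonoid.zsmul_neg' n f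
  neg_add_cancel f := neg_add_cancel f
  nsmul n f := n • f
  nsmul_zero := zero_nsmul
  nsmul_succ n f := succ_nsmul f n
  sub f g := f - g
  sub_eq_add_neg := sub_eq_add_neg

theorem smul_mul' {F : Type*} [CommRing F] [Algebra F R] (c : F) (f g : WordSeries I R) :
    (c • f) * g = c • (f * g) := by
  ext w
  induction w generalizing f g with
  | nil => simp
  | cons a w ih => simp [mul_cons, ih]

instance {F : Type*} [CommRing F] [Algebra F R] :
    IsScalarTower F (WordSeries I R) (WordSeries I R) := ⟨smul_mul'⟩

instance {F : Type*} [CommRing F] [Algebra F R] :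
    SMulCommClass F (WordSeries I R) (WordSeries I R) :=
  ⟨fun c f g => by simp only [smul_eq_mul]; rw [mul_comm f, ← smul_mul', mul_comm]⟩

/-- The constant coefficient, as a ring homomorphism. -/
def constHom : WordSeries I R →+* R where
  toFun f := f []
  map_one' := rfl
  map_mul' _ _ := rfl
  map_zero' := rfl
  map_add' _ _ := rfl

/-- The shift as a derivation. -/
def shiftDer (a : I) : Derivation ℤ (WordSeries I R) (WordSeries I R) where
  toFun f := shift a f
  map_add' _ _ := rfl
  map_smul' n f := by
    exact map_zsmul (AddMonoidHom.mk' (shift (R := R) a) fun _ _ => rfl) n f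
  map_one_eq_zero' := rfl
  leibniz' f g := by
    change shift a (f * g) = _
    change _ = f * shift a g + g * shift a f
    rw [shift_mul]
    ring

theorem shift_sum {ι : Type*} (a : I) (s : Finset ι) (f : ι → WordSeries I R) :
    shift a (∑ i ∈ s, f i) = ∑ i ∈ s, shift a (f i) := map_sum (shiftDer a) f s

theorem shift_nsmul (a : I) (n : ℕ) (f : WordSeries I R) :
    shift a (n • f) = n • shift a f := map_nsmul (shiftDer a) n f

theorem shift_natCast_mul (a : I) (n : ℕ) (f : WordSeries I R) :
    shift a ((n : WordSeries I R) * f) = (n : WordSeries I R) * shift a f := by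
  rw [← nsmul_eq_mul, shift_nsmul, nsmul_eq_mul]

theorem shift_prod {ι : Type*} [DecidableEq ι] (a : I) (s : Finset ι) (f : ι → WordSeries I R) :
    shift a (∏ i ∈ s, f i) = ∑ i ∈ s, (∏ k ∈ s.erase i, f k) * shift a (f i) := by
  induction s using Finset.induction_on with
  | empty => simp
  | insert i s hi ih =>
    rw [Finset.prod_insert hi, shift_mul, ih, Finset.sum_insert hi, Finset.erase_insert hi,
      Finset.mul_sum, mul_comm]
    congr 1
    refine Finset.sum_congr rfl fun k hk => ?_
    rw [Finset.erase_insert_of_ne (by rintro rfl; exact hi hk), Finset.prod_insert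
      (fun h => hi (Finset.mem_of_mem_erase h)), mul_assoc]

/-! ### Half shuffles and divided powers -/

/-- The half shuffle `x ≺ y`: the part of the shuffle product in which the first letter comes
from `x`. -/
def prec (x y : WordSeries I R) : WordSeries I R
  | [] => 0
  | a :: w => (shift a x * y) w

@[simp] theorem prec_nil (x y : WordSeries I R) : prec x y [] = 0 := rfl

@[simp] theorem shift_prec (a : I) (x y : WordSeries I R) :
    shift a (prec x y) = shift a x * y := rfl

theorem prec_one {x : WordSeries I R} (hx : x [] = 0) : prec x 1 = x :=
  ext_shift hx.symm (by simp)

theorem prec_add (x y z : WordSeries I R) : prec x (y + z) = prec x y + prec x z :=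
  ext_shift (by simp) fun a => by simp [mul_add]

theorem add_prec (x y z : WordSeries I R) : prec (x + y) z = prec x z + prec y z :=
  ext_shift (by simp) fun a => by simp [add_mul]

theorem prec_smul {F : Type*} [CommRing F] [Algebra F R] (c : F) (x y : WordSeries I R) :
    prec x (c • y) = c • prec x y :=
  ext_shift (by simp) fun a => mul_smul_comm c (shift a x) y

theorem smul_prec {F : Type*} [CommRing F] [Algebra F R] (c : F) (x y : WordSeries I R) :
    prec (c • x) y = c • prec x y :=
  ext_shift (by simp) fun a => smul_mul_assoc c (shift a x) y

/-- The half shuffle as a bilinear map. -/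
def precₗ (F : Type*) [CommRing F] [Algebra F R] :
    WordSeries I R →ₗ[F] WordSeries I R →ₗ[F] WordSeries I R :=
  LinearMap.mk₂ F prec add_prec smul_prec prec_add prec_smul

@[simp] theorem precₗ_apply (F : Type*) [CommRing F] [Algebra F R] (x y : WordSeries I R) :
    precₗ F x y = prec x y := rfl

/-- The divided powers of a series without constant coefficient: `γ₀(x) = 1` and
`γ_{n+1}(x) = x ≺ γ_n(x)`. -/
def dpow : ℕ → WordSeries I R → WordSeries I R
  | 0, _ => 1
  | n + 1, x => prec x (dpow n x)

@[simp] theorem dpow_zero (x : WordSeries I R) : dpow 0 x = 1 := rfl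

theorem dpow_succ (n : ℕ) (x : WordSeries I R) : dpow (n + 1) x = prec x (dpow n x) := rfl

@[simp] theorem dpow_succ_nil (n : ℕ) (x : WordSeries I R) : dpow (n + 1) x [] = 0 := rfl

theorem dpow_nil {n : ℕ} (hn : 0 < n) (x : WordSeries I R) : dpow n x [] = 0 := by
  cases n with
  | zero => omega
  | succ n => rfl

@[simp] theorem shift_dpow_succ (a : I) (n : ℕ) (x : WordSeries I R) :
    shift a (dpow (n + 1) x) = shift a x * dpow n x := rfl

theorem dpow_one {x : WordSeries I R} (hx : x [] = 0) : dpow 1 x = x := prec_one hx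

theorem dpow_zero_right {n : ℕ} (hn : 0 < n) : dpow n (0 : WordSeries I R) = 0 := by
  cases n with
  | zero => omega
  | succ n => exact ext_shift (by simp) fun a => by simp

/-- `γ₁(x) γ_n(x) = (n + 1) γ_{n+1}(x)`; this and the identities below are proved by comparing
constant coefficients and shifts. -/
theorem mul_dpow {x : WordSeries I R} (hx : x [] = 0) (n : ℕ) :
    x * dpow n x = (n + 1 : ℕ) * dpow (n + 1) x := by
  induction n with
  | zero => simp [dpow_one hx]
  | succ n ih =>
    refine ext_shift (by simp [hx]) fun a => ?_
    rw [shift_mul, shift_natCast_mul, shift_dpow_succ, shift_dpow_succ, mul_left_comm x, ih]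
    push_cast
    ring

theorem dpow_mul_dpow (x : WordSeries I R) (m n : ℕ) :
    dpow m x * dpow n x = ((m + n).choose m : ℕ) * dpow (m + n) x := by
  induction hN : m + n generalizing m n with
  | zero =>
    obtain ⟨rfl, rfl⟩ : m = 0 ∧ n = 0 := by omega
    simp
  | succ N ih =>
    cases m with
    | zero => obtain rfl : n = N + 1 := by omega
              simp
    | succ m =>
      cases n with
      | zero => obtain rfl : m = N := by omega
                simp
      | succ n =>
        refine ext_shift (by simp) fun a => ?_
        rw [shift_mul, shift_natCast_mul, shift_dpow_succ, shift_dpow_succ, shift_dpow_succ,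
          mul_assoc, ih m (n + 1) (by omega), mul_left_comm (dpow (m + 1) x),
          ih (m + 1) n (by omega),
          Nat.choose_succ_succ]
        push_cast
        ring

theorem dpow_mul (x : WordSeries I R) {y : WordSeries I R} (hy : y [] = 0) (n : ℕ) :
    dpow n (x * y) = x ^ n * dpow n y := by
  induction n with
  | zero => simp
  | succ n ih =>
    refine ext_shift (by simp) fun a => ?_
    have hpow : shift a (x ^ (n + 1)) = (n + 1 : ℕ) * x ^ n * shift a x := by
      have h := (shiftDer a).leibniz_pow x (n + 1)
      rwa [nsmul_eq_mul, smul_eq_mul, Nat.add_sub_cancel, ← mul_assoc] at h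
    have h := mul_dpow hy n
    rw [shift_mul, hpow, shift_dpow_succ, shift_dpow_succ, shift_mul, ih]
    linear_combination (x ^ n * shift a x) * h

theorem factorial_mul_dpow {x : WordSeries I R} (hx : x [] = 0) (n : ℕ) :
    (n ! : ℕ) * dpow n x = x ^ n := by
  induction n with
  | zero => simp
  | succ n ih =>
    have h := mul_dpow hx n
    rw [pow_succ, ← ih, Nat.factorial_succ]
    push_cast at h ⊢
    linear_combination -(n ! : WordSeries I R) * h

theorem dpow_dpow (x : WordSeries I R) (r : ℕ) {q : ℕ} (hq : 0 < q) :
    dpow r (dpow q x) = (r.uniformBell q : ℕ) * dpow (r * q) x := by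
  induction r with
  | zero => simp [Nat.uniformBell_zero_left]
  | succ r ih =>
    obtain ⟨q, rfl⟩ : ∃ l, q = l + 1 := ⟨q - 1, by omega⟩
    have e : (r + 1) * (q + 1) = (r * (q + 1) + q) + 1 := by ring
    rw [e]
    refine ext_shift (by simp) fun a => ?_
    have h := dpow_mul_dpow x q (r * (q + 1))
    rw [shift_natCast_mul, shift_dpow_succ, shift_dpow_succ, shift_dpow_succ, ih,
      Nat.uniformBell_succ_left]
    have e2 : r * (q + 1) + (q + 1) - 1 = q + r * (q + 1) := by omega
    rw [e2, Nat.add_sub_cancel, add_comm (r * (q + 1)) q]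
    push_cast at h ⊢
    linear_combination (shift a x * (r.uniformBell (q + 1) : WordSeries I R)) * h

theorem prod_dpow_nil {ι : Type*} (s : Finset ι) (x : ι → WordSeries I R) (q : ι → ℕ)
    (h : ∃ i ∈ s, 0 < q i) : (∏ i ∈ s, dpow (q i) (x i)) [] = 0 := by
  obtain ⟨i, hi, hq⟩ := h
  refine (map_prod (constHom (I := I) (R := R)) _ s).trans (Finset.prod_eq_zero hi ?_)
  exact dpow_nil hq _

theorem dpow_dpow_prod_succ (r : ℕ) {k : ℕ} (x : Fin (k + 1) → WordSeries I R)
    (q : Fin (k + 1) → ℕ) (hq : ∀ j, 0 < q j) :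
    dpow r (∏ j, dpow (q j) (x j)) = (mulCoeff r q : ℕ) * ∏ j, dpow (r * q j) (x j) := by
  have hcoeff : mulCoeff r q =
      r.uniformBell (q 0) * ∏ j : Fin k, (r ! * r.uniformBell (q j.succ)) := by
    have h := mulCoeff_mul (Nat.succ_pos k) r q hq
    have hpos : 0 < r ! * ∏ j, (q j)! ^ r :=
      mul_pos (Nat.factorial_pos r) (Finset.prod_pos fun j _ => pow_pos (Nat.factorial_pos _) _)
    refine Nat.eq_of_mul_eq_mul_right hpos (h.trans ?_)
    rw [Fin.prod_univ_succ, Fin.prod_univ_succ, ← Nat.uniformBell_mul_eq r (hq 0).ne']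
    have h2 : ∀ j : Fin k, (r * q j.succ)! =
        (r ! * r.uniformBell (q j.succ)) * (q j.succ)! ^ r := fun j => by
      rw [← Nat.uniformBell_mul_eq r (hq j.succ).ne']
      ring
    simp only [h2, Finset.prod_mul_distrib]
    ring
  rw [Fin.prod_univ_succ, mul_comm (dpow (q 0) (x 0)), dpow_mul _ (dpow_nil (hq 0) _),
    dpow_dpow _ _ (hq 0), ← Finset.prod_pow, Fin.prod_univ_succ, hcoeff]
  have h3 : ∀ j : Fin k, dpow (q j.succ) (x j.succ) ^ r =
      ((r ! * r.uniformBell (q j.succ) : ℕ) : WordSeries I R) *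
        dpow (r * q j.succ) (x j.succ) := fun j => by
    rw [← factorial_mul_dpow (dpow_nil (hq j.succ) _), dpow_dpow _ _ (hq j.succ)]
    push_cast
    ring
  simp only [h3, Finset.prod_mul_distrib]
  push_cast
  rw [Finset.prod_mul_distrib]
  ring

/-- The divided powers of a product of divided powers: the first factor goes inside `γ_r` by
`dpow_dpow`, and the others come out as `r`-th powers by `dpow_mul`. -/
theorem dpow_prod_dpow (r : ℕ) {k : ℕ} (hk : 0 < k) (x : Fin k → WordSeries I R)
    (q : Fin k → ℕ) (hq : ∀ j, 0 < q j) :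
    dpow r (∏ j, dpow (q j) (x j)) = (mulCoeff r q : ℕ) * ∏ j, dpow (r * q j) (x j) := by
  obtain ⟨k, rfl⟩ : ∃ l, k = l + 1 := ⟨k - 1, by omega⟩
  exact dpow_dpow_prod_succ r x q hq

/-- A product of divided powers, sorted by the factor that contributes the first letter. -/
theorem prod_dpow_eq_sum_prec {ι : Type*} [Fintype ι] [DecidableEq ι] (x : ι → WordSeries I R)
    (r : ι → ℕ) (hr : ∃ i, 0 < r i) :
    ∏ i, dpow (r i) (x i) = ∑ i, if 0 < r i then
      prec (x i) (∏ k, dpow (Function.update r i (r i - 1) k) (x k)) else 0 := by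
  obtain ⟨i₀, hi₀⟩ := hr
  refine ext_shift ?_ fun a => ?_
  · rw [prod_dpow_nil _ _ _ ⟨i₀, Finset.mem_univ _, hi₀⟩]
    refine ((map_sum (constHom (I := I) (R := R)) _ Finset.univ).trans
      (Finset.sum_eq_zero fun i _ => ?_)).symm
    split_ifs
    · rfl
    · rfl
  · rw [shift_prod, shift_sum]
    refine Finset.sum_congr rfl fun i _ => ?_
    cases h : r i with
    | zero => simp
    | succ n =>
      rw [if_pos (Nat.succ_pos n), shift_prec, shift_dpow_succ,
        ← Finset.mul_prod_erase Finset.univ _ (Finset.mem_univ i)]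
      have : ∏ k ∈ Finset.univ.erase i, dpow (Function.update r i (n + 1 - 1) k) (x k) =
          ∏ k ∈ Finset.univ.erase i, dpow (r k) (x k) :=
        Finset.prod_congr rfl fun k hk => by
          rw [Function.update_of_ne (Finset.ne_of_mem_erase hk)]
      rw [this, Function.update_self, Nat.add_sub_cancel]
      ring

end Ring

/-! ### Change of coefficients -/

section Map

variable [CommRing R] [CommRing S]

/-- Change of coefficients along a ring homomorphism. -/
def map (θ : R →+* S) : WordSeries I R →+* WordSeries I S where
  toFun f w := θ (f w)
  map_zero' := by ext w; exact map_zero θ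
  map_add' f g := by ext w; exact map_add θ _ _
  map_one' := by
    ext w
    cases w
    · exact map_one θ
    · exact map_zero θ
  map_mul' f g := by
    ext w
    induction w generalizing f g with
    | nil => exact map_mul θ _ _
    | cons a w ih =>
      simp only [mul_cons, map_add]
      exact congrArg₂ (· + ·) (ih (shift a f) g) (ih f (shift a g))

@[simp] theorem map_apply (θ : R →+* S) (f : WordSeries I R) (w : List I) :
    map θ f w = θ (f w) := rfl

theorem shift_map (θ : R →+* S) (a : I) (f : WordSeries I R) :
    shift a (map θ f) = map θ (shift a f) := rfl

theorem map_prec (θ : R →+* S) (x y : WordSeries I R) :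
    map θ (prec x y) = prec (map θ x) (map θ y) :=
  ext_shift (by simp) fun a => by rw [shift_map, shift_prec, shift_prec, map_mul, shift_map]

theorem map_dpow (θ : R →+* S) (n : ℕ) (x : WordSeries I R) :
    map θ (dpow n x) = dpow n (map θ x) := by
  induction n with
  | zero => exact map_one _
  | succ n ih => rw [dpow_succ, map_prec, ih, dpow_succ]

/-- The coefficientwise linear map along an `F`-algebra homomorphism. -/
def mapₗ {F : Type*} [CommRing F] [Algebra F R] [Algebra F S] (θ : R →ₐ[F] S) :
    WordSeries I R →ₗ[F] WordSeries I S where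
  toFun := map (θ : R →+* S)
  map_add' := map_add _
  map_smul' c f := by ext w; simp

@[simp] theorem mapₗ_apply {F : Type*} [CommRing F] [Algebra F R] [Algebra F S] (θ : R →ₐ[F] S)
    (f : WordSeries I R) : mapₗ θ f = map (θ : R →+* S) f := rfl

end Map

/-! ### Coefficients in the dual numbers -/

section Dual

/-- The coefficientwise `ε`-part of a series with coefficients in the dual numbers. -/
def epsPart (f : WordSeries I (DualNumber R)) : WordSeries I R := fun w => (f w).snd

@[simp] theorem epsPart_apply (f : WordSeries I (DualNumber R)) (w : List I) :
    epsPart f w = (f w).snd := rfl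

/-- The series `f + ε g` with coefficients in the dual numbers. -/
def addEps (f g : WordSeries I R) : WordSeries I (DualNumber R) := fun w => (f w, g w)

variable [CommRing R]

/-- Reduction modulo `ε`. -/
def modEps : WordSeries I (DualNumber R) →+* WordSeries I R :=
  map (TrivSqZeroExt.fstHom R R R).toRingHom

@[simp] theorem modEps_apply (f : WordSeries I (DualNumber R)) (w : List I) :
    modEps f w = (f w).fst := rfl

theorem addEps_nil {f g : WordSeries I R} (hf : f [] = 0) (hg : g [] = 0) :
    addEps f g [] = 0 := by
  change ((f [], g []) : R × R) = (0, 0)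
  rw [hf, hg]

/-- The product rule for the coefficient of `ε`. -/
theorem epsPart_mul (f g : WordSeries I (DualNumber R)) :
    epsPart (f * g) = modEps f * epsPart g + modEps g * epsPart f := by
  ext w
  induction w generalizing f g with
  | nil => simp [mul_comm]
  | cons a w ih =>
    have h : epsPart (f * g) (a :: w) =
        epsPart (shift a f * g) w + epsPart (f * shift a g) w := rfl
    rw [h, ih, ih]
    simp only [add_apply, mul_cons]
    change _ = _ + (modEps f * epsPart (shift a g)) w +
      (_ + (modEps g * epsPart (shift a f)) w)
    have e₁ : shift a (modEps f) = modEps (shift a f) := rfl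
    have e₂ : shift a (modEps g) = modEps (shift a g) := rfl
    rw [e₁, e₂]
    ring

theorem epsPart_one : epsPart (1 : WordSeries I (DualNumber R)) = 0 := by
  ext w
  cases w
  · rfl
  · rfl

/-- The derivative of `γ_{n+1}` is `γ_n`. -/
theorem epsPart_dpow_succ (n : ℕ) (x : WordSeries I (DualNumber R)) (hx : epsPart x [] = 0) :
    epsPart (dpow (n + 1) x) = dpow n (modEps x) * epsPart x := by
  induction n with
  | zero =>
    refine ext_shift (by simpa using hx.symm) fun a => ?_
    change epsPart (shift a x * 1) = _
    simp
    rfl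
  | succ n ih =>
    refine ext_shift (by simp) fun a => ?_
    change epsPart (shift a x * dpow (n + 1) x) = _
    rw [epsPart_mul, ih, shift_mul, shift_dpow_succ, modEps, map_dpow, shift_map]
    change _ + _ * epsPart (shift a x) = _ + _ * epsPart (shift a x)
    ring

theorem epsPart_prod {ι : Type*} [DecidableEq ι] (s : Finset ι)
    (f : ι → WordSeries I (DualNumber R)) :
    epsPart (∏ i ∈ s, f i) = ∑ i ∈ s, (∏ k ∈ s.erase i, modEps (f k)) * epsPart (f i) := by
  induction s using Finset.induction_on with
  | empty => simp [epsPart_one]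
  | insert i s hi ih =>
    rw [Finset.prod_insert hi, epsPart_mul, ih, Finset.sum_insert hi, Finset.erase_insert hi,
      Finset.mul_sum, map_prod, add_comm]
    congr 1
    refine Finset.sum_congr rfl fun k hk => ?_
    rw [Finset.erase_insert_of_ne (by rintro rfl; exact hi hk), Finset.prod_insert
      (fun h => hi (Finset.mem_of_mem_erase h)), mul_assoc]

/-- The `ε`-part of a product of divided powers. -/
theorem epsPart_prod_dpow {ι : Type*} [Fintype ι] [DecidableEq ι]
    (x : ι → WordSeries I (DualNumber R)) (hx : ∀ i, epsPart (x i) [] = 0) (r : ι → ℕ)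
    (hr : ∀ i, 0 < r i) :
    epsPart (∏ i, dpow (r i) (x i)) =
      ∑ i, (∏ k, dpow (Function.update r i (r i - 1) k) (modEps (x k))) * epsPart (x i) := by
  rw [epsPart_prod]
  refine Finset.sum_congr rfl fun i _ => ?_
  obtain ⟨n, hn⟩ : ∃ n, r i = n + 1 := ⟨r i - 1, by have := hr i; omega⟩
  rw [hn, epsPart_dpow_succ _ _ (hx i), ← Finset.mul_prod_erase Finset.univ _ (Finset.mem_univ i),
    Function.update_self, Nat.add_sub_cancel]
  have : ∏ k ∈ Finset.univ.erase i, dpow (Function.update r i n k) (modEps (x k)) =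
      ∏ k ∈ Finset.univ.erase i, modEps (dpow (r k) (x k)) :=
    Finset.prod_congr rfl fun k hk => by
      rw [Function.update_of_ne (Finset.ne_of_mem_erase hk), modEps, map_dpow]
  rw [this]
  ring

/-- The coefficientwise `ε`-part as a linear map. -/
def epsPartₗ (F : Type*) [CommRing F] [Algebra F R] :
    WordSeries I (DualNumber R) →ₗ[F] WordSeries I R where
  toFun := epsPart
  map_add' _ _ := rfl
  map_smul' _ _ := rfl

@[simp] theorem epsPartₗ_apply (F : Type*) [CommRing F] [Algebra F R]
    (f : WordSeries I (DualNumber R)) : epsPartₗ F f = epsPart f := rfl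

end Dual

end WordSeries

/-! ### Linear maps from symmetric tensors to word series -/

noncomputable section

open WordSeries

section Lift

variable {F V W : Type u} [Field F] [AddCommGroup V] [Module F V] [AddCommGroup W] [Module F W]
variable {I R S : Type*} [CommRing R] [Algebra F R] [CommRing S] [Algebra F S]

/-- The iterated half shuffle `ψ(v₁) ≺ (ψ(v₂) ≺ (⋯ ≺ 1))`. -/
def iterPrec (ψ : V →ₗ[F] WordSeries I R) :
    (n : ℕ) → MultilinearMap F (fun _ : Fin n => V) (WordSeries I R)
  | 0 => MultilinearMap.constOfIsEmpty F _ 1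
  | n + 1 => LinearMap.uncurryLeft (M := fun _ => V)
    { toFun := fun v => (precₗ F (ψ v)).compMultilinearMap (iterPrec ψ n)
      map_add' := fun v w => by ext; simp
      map_smul' := fun c v => by ext; simp }

@[simp] theorem iterPrec_zero (ψ : V →ₗ[F] WordSeries I R) (v : Fin 0 → V) :
    iterPrec ψ 0 v = 1 := rfl

@[simp] theorem iterPrec_succ (ψ : V →ₗ[F] WordSeries I R) (n : ℕ) (v : Fin (n + 1) → V) :
    iterPrec ψ (n + 1) v = prec (ψ (v 0)) (iterPrec ψ n (Fin.tail v)) := rfl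

/-- The linear map `Γ(V) → WordSeries I R` given by the iterated half shuffles of `ψ`. It sends
divided power monomials to products of divided powers, see `gamLift_dpMonomial`. -/
def gamLift (ψ : V →ₗ[F] WordSeries I R) : Gam F V →ₗ[F] WordSeries I R :=
  DirectSum.toModule F _ _ fun n =>
    PiTensorProduct.lift (iterPrec ψ n.1) ∘ₗ (symTensors F V n.1).subtype

theorem gamLift_of (ψ : V →ₗ[F] WordSeries I R) (n : {n : ℕ // 0 < n}) (t : symTensors F V n.1) :
    gamLift ψ (DirectSum.of (fun n : {n : ℕ // 0 < n} => symTensors F V n.1) n t) =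
      PiTensorProduct.lift (iterPrec ψ n.1) t.1 := by
  rw [← DirectSum.lof_eq_of F, gamLift, DirectSum.toModule_lof]
  rfl

/-- Splitting off the first letter of a word: the sum over the rearrangements of a word satisfies
the same recursion as the product of divided powers, see `prod_dpow_eq_sum_prec`. -/
theorem sum_iterPrec_eq_prod_dpow {ι : Type} [Fintype ι] [DecidableEq ι]
    (ψ : V →ₗ[F] WordSeries I R) (v : ι → V) (n : ℕ) (r : ι → ℕ) (hr : ∑ i, r i = n) :
    ∑ w : Fin n → ι with ∀ i, (Finset.univ.filter fun k => w k = i).card = r i,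
      iterPrec ψ n (fun k => v (w k)) = ∏ i, dpow (r i) (ψ (v i)) := by
  induction n generalizing r with
  | zero =>
    have h0 : ∀ i, r i = 0 := fun i =>
      (Finset.sum_eq_zero_iff.mp hr) i (Finset.mem_univ i)
    rw [Finset.filter_true_of_mem fun w _ i => by simp [h0 i]]
    simp [h0]
  | succ n ih =>
    have hex : ∃ i, 0 < r i := by
      by_contra hcon
      push Not at hcon
      have : ∑ i, r i = 0 := Finset.sum_eq_zero fun i _ => by have := hcon i; omega
      omega
    rw [prod_dpow_eq_sum_prec _ _ hex, Finset.sum_filter,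
      ← Fintype.sum_equiv (Fin.consEquiv fun _ => ι) _ _ (fun _ => rfl), Fintype.sum_prod_type]
    refine Finset.sum_congr rfl fun i _ => ?_
    have hcount : ∀ (w : Fin n → ι),
        (∀ j, (Finset.univ.filter fun k => Fin.consEquiv (fun _ => ι) (i, w) k = j).card = r j) ↔
          0 < r i ∧ ∀ j, (Finset.univ.filter fun k => w k = j).card =
            Function.update r i (r i - 1) j := by
      intro w
      have hc : ∀ j, (Finset.univ.filter fun k => Fin.consEquiv (fun _ => ι) (i, w) k = j).card =
          (if i = j then 1 else 0) + (Finset.univ.filter fun k => w k = j).card := fun j => by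
        rw [Fin.card_filter_univ_succ']
        rfl
      simp only [hc]
      constructor
      · intro h
        have hi := h i
        rw [if_pos rfl] at hi
        refine ⟨by omega, fun j => ?_⟩
        by_cases hj : j = i
        · subst hj
          rw [Function.update_self]
          omega
        · have := h j
          rw [if_neg (Ne.symm hj)] at this
          rw [Function.update_of_ne hj]
          omega
      · rintro ⟨hpos, h⟩ j
        have := h j
        by_cases hj : j = i
        · subst hj
          rw [Function.update_self] at this
          rw [if_pos rfl]
          omega
        · rw [Function.update_of_ne hj] at this
          rw [if_neg (Ne.symm hj)]
          omega
    simp only [hcount]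
    by_cases hi : 0 < r i
    · rw [if_pos hi, ← ih]
      · rw [← precₗ_apply F, map_sum, Finset.sum_filter]
        simp only [hi, true_and]
        rfl
      · have h1 := Finset.sum_update_of_mem (Finset.mem_univ i) r (r i - 1)
        have h2 := Finset.add_sum_erase Finset.univ r (Finset.mem_univ i)
        rw [Finset.sdiff_singleton_eq_erase] at h1
        omega
    · simp [hi]

/-- `gamLift ψ` sends `v₁^{[r₁]} * ⋯ * v_n^{[r_n]}` to `∏ γ_{r_i}(ψ(v_i))`. -/
theorem gamLift_dpMonomial {ι : Type} [Fintype ι] [DecidableEq ι] (ψ : V →ₗ[F] WordSeries I R)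
    (v : ι → V) (r : ι → ℕ) (hr : 0 < ∑ i, r i) :
    gamLift ψ (dpMonomial v r) = ∏ i, dpow (r i) (ψ (v i)) := by
  rw [dpMonomial, dif_pos hr, gamLift_of, ← sum_iterPrec_eq_prod_dpow ψ v _ r rfl]
  change PiTensorProduct.lift (iterPrec ψ _) (dpTensor v r) = _
  rw [dpTensor, map_sum]
  exact Finset.sum_congr rfl fun w _ => PiTensorProduct.lift.tprod _

/-- The image of `gamLift` has no constant coefficient, because `Γ(V)` has no part of degree `0`. -/
theorem gamLift_nil (ψ : V →ₗ[F] WordSeries I R) (t : Gam F V) : gamLift ψ t [] = 0 := by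
  induction t using DirectSum.induction_on with
  | zero => rw [map_zero]; rfl
  | add x y hx hy => rw [map_add, WordSeries.add_apply, hx, hy, add_zero]
  | of n t =>
    rw [gamLift_of]
    obtain ⟨_ | m, hn⟩ := n
    · exact absurd hn (lt_irrefl 0)
    generalize t.1 = t
    dsimp only at t ⊢
    induction t using PiTensorProduct.induction_on with
    | smul_tprod c v =>
      rw [map_smul, PiTensorProduct.lift.tprod, iterPrec_succ, WordSeries.smul_apply, prec_nil, smul_zero]
    | add x y hx hy => rw [map_add, WordSeries.add_apply, hx, hy, add_zero]

theorem iterPrec_comp (ψ : W →ₗ[F] WordSeries I R) (f : V →ₗ[F] W) (n : ℕ) (v : Fin n → V) :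
    iterPrec (ψ ∘ₗ f) n v = iterPrec ψ n fun k => f (v k) := by
  induction n with
  | zero => rfl
  | succ n ih => rw [iterPrec_succ, ih, iterPrec_succ]; rfl

theorem map_iterPrec (ψ : V →ₗ[F] WordSeries I R) (θ : R →ₐ[F] S) (n : ℕ) (v : Fin n → V) :
    map (θ : R →+* S) (iterPrec ψ n v) = iterPrec (mapₗ θ ∘ₗ ψ) n v := by
  induction n with
  | zero => exact map_one _
  | succ n ih => rw [iterPrec_succ, map_prec, ih, iterPrec_succ]; rfl

/-- Two linear maps on `Γ(V)` agree if they are restrictions of maps that agree on pure tensors. -/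
theorem gam_linearMap_ext {M : Type*} [AddCommMonoid M] [Module F M] {f g : Gam F V →ₗ[F] M}
    (f' g' : ∀ n : ℕ, (⨂[F]^n V) →ₗ[F] M)
    (hf : ∀ (n : {n : ℕ // 0 < n}) (t : symTensors F V n.1),
      f (DirectSum.of (fun n : {n : ℕ // 0 < n} => symTensors F V n.1) n t) = f' n.1 t.1)
    (hg : ∀ (n : {n : ℕ // 0 < n}) (t : symTensors F V n.1),
      g (DirectSum.of (fun n : {n : ℕ // 0 < n} => symTensors F V n.1) n t) = g' n.1 t.1)
    (h : ∀ (n : ℕ) (v : Fin n → V),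
      f' n (PiTensorProduct.tprod F v) = g' n (PiTensorProduct.tprod F v)) : f = g := by
  refine DirectSum.linearMap_ext F fun n => LinearMap.ext fun t => ?_
  rw [LinearMap.comp_apply, LinearMap.comp_apply, DirectSum.lof_eq_of, hf, hg]
  refine congrArg (fun k : (⨂[F]^n.1 V) →ₗ[F] M => k t.1) (PiTensorProduct.ext ?_)
  ext v
  exact h n.1 v

theorem gamLift_comp_gamMap (ψ : W →ₗ[F] WordSeries I R) (f : V →ₗ[F] W) :
    gamLift ψ ∘ₗ gamMap f = gamLift (ψ ∘ₗ f) := by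
  refine gam_linearMap_ext
    (fun n => PiTensorProduct.lift (iterPrec ψ n) ∘ₗ PiTensorProduct.map fun _ => f)
    (fun n => PiTensorProduct.lift (iterPrec (ψ ∘ₗ f) n)) ?_ (gamLift_of _) ?_
  · intro n t
    rw [LinearMap.comp_apply, gamMap, DirectSum.lmap_of, gamLift_of]
    rfl
  · intro n v
    rw [LinearMap.comp_apply, PiTensorProduct.map_tprod, PiTensorProduct.lift.tprod,
      PiTensorProduct.lift.tprod, iterPrec_comp]

theorem mapₗ_comp_gamLift (ψ : V →ₗ[F] WordSeries I R) (θ : R →ₐ[F] S) :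
    mapₗ θ ∘ₗ gamLift ψ = gamLift (mapₗ θ ∘ₗ ψ) := by
  refine gam_linearMap_ext (fun n => mapₗ θ ∘ₗ PiTensorProduct.lift (iterPrec ψ n))
    (fun n => PiTensorProduct.lift (iterPrec (mapₗ θ ∘ₗ ψ) n)) ?_ (gamLift_of _) ?_
  · intro n t
    rw [LinearMap.comp_apply, gamLift_of]
    rfl
  · intro n v
    rw [LinearMap.comp_apply, PiTensorProduct.lift.tprod, PiTensorProduct.lift.tprod,
      mapₗ_apply, map_iterPrec]

theorem gamLift_gamUnit {ψ : V →ₗ[F] WordSeries I R} (hψ : ∀ v, ψ v [] = 0) :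
    gamLift ψ ∘ₗ gamUnit F V = ψ := by
  ext1 v
  rw [LinearMap.comp_apply, gamUnit_apply, gamLift_dpMonomial _ _ _ (by simp)]
  simp [dpow_one (hψ v)]

end Lift

/-! ### The embedding into word series of functionals -/

section Embedding

variable (F V : Type u) [Field F] [AddCommGroup V] [Module F V]

/-- A vector `v` as a linear combination of letters: the coefficient at the one-letter word `f`,
for a functional `f`, is `f v`. -/
def letters : V →ₗ[F] WordSeries (Module.Dual F V) F where
  toFun v
    | [f] => f v
    | _ => 0
  map_add' v v' := by
    ext w
    rcases w with _ | ⟨f, _ | ⟨g, w⟩⟩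
    · exact (add_zero _).symm
    · exact map_add f v v'
    · exact (add_zero _).symm
  map_smul' c v := by
    ext w
    rcases w with _ | ⟨f, _ | ⟨g, w⟩⟩
    · exact (mul_zero _).symm
    · exact map_smul f c v
    · exact (mul_zero _).symm

variable {F V}

@[simp] theorem letters_nil (v : V) : letters F V v [] = 0 := rfl

theorem shift_letters (f : Module.Dual F V) (v : V) : shift f (letters F V v) = f v • 1 := by
  ext w
  cases w with
  | nil => exact (mul_one _).symm
  | cons g w => exact (mul_zero _).symm

theorem iterPrec_letters_cons (n : ℕ) (v : Fin (n + 1) → V) (f : Module.Dual F V)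
    (w : List (Module.Dual F V)) :
    iterPrec (letters F V) (n + 1) v (f :: w) =
      f (v 0) * iterPrec (letters F V) n (Fin.tail v) w := by
  rw [iterPrec_succ]
  change (shift f (letters F V (v 0)) * _) w = _
  rw [shift_letters, smul_mul_assoc, one_mul]
  rfl

theorem iterPrec_letters_ofFn (n : ℕ) (v : Fin n → V) (f : Fin n → Module.Dual F V) :
    iterPrec (letters F V) n v (List.ofFn f) = ∏ i, f i (v i) := by
  induction n with
  | zero => simp
  | succ n ih =>
    rw [List.ofFn_succ, iterPrec_letters_cons, ih, Fin.prod_univ_succ]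
    rfl

theorem iterPrec_letters_of_length_ne (n : ℕ) (v : Fin n → V) (w : List (Module.Dual F V))
    (hw : w.length ≠ n) : iterPrec (letters F V) n v w = 0 := by
  induction n generalizing w with
  | zero =>
    cases w with
    | nil => simp at hw
    | cons f w => rfl
  | succ n ih =>
    cases w with
    | nil => rfl
    | cons f w =>
      rw [iterPrec_letters_cons, ih _ _ (by simpa using hw), mul_zero]

/-- Products of functionals separate tensors. -/
theorem tensor_ext_of_functionals (n : ℕ) (s t : ⨂[F]^n V)
    (h : ∀ f : Fin n → Module.Dual F V,
      PiTensorProduct.lift (iterPrec (letters F V) n) s (List.ofFn f) =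
        PiTensorProduct.lift (iterPrec (letters F V) n) t (List.ofFn f)) : s = t := by
  let b := Module.Basis.ofVectorSpace F V
  let B := Basis.piTensorProduct fun _ : Fin n => b
  refine B.ext_elem fun p => ?_
  let ev : WordSeries (Module.Dual F V) F →ₗ[F] F := LinearMap.proj (List.ofFn fun k => b.coord (p k))
  have key : B.coord p = ev ∘ₗ PiTensorProduct.lift (iterPrec (letters F V) n) := by
    refine PiTensorProduct.ext ?_
    ext v
    change B.repr (PiTensorProduct.tprod F v) p =
      PiTensorProduct.lift (iterPrec (letters F V) n) (PiTensorProduct.tprod F v)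
        (List.ofFn fun k => b.coord (p k))
    rw [PiTensorProduct.lift.tprod, iterPrec_letters_ofFn]
    exact Basis.piTensorProduct_repr_tprod_apply _ _ _
  exact (LinearMap.congr_fun key s).trans ((h _).trans (LinearMap.congr_fun key t).symm)

variable (F V) in
/-- The embedding of `Γ(V)` into the shuffle algebra. -/
def gamEmb : Gam F V →ₗ[F] WordSeries (Module.Dual F V) F := gamLift (letters F V)

/-- Symmetric tensors of different degrees are told apart by the length of the words, and those of
one degree by products of functionals. -/
theorem gamEmb_injective : Function.Injective (gamEmb F V) := by
  intro s t hst
  refine DFinsupp.ext fun n => Subtype.ext (tensor_ext_of_functionals _ _ _ fun f => ?_)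
  let ev : WordSeries (Module.Dual F V) F →ₗ[F] F := LinearMap.proj (List.ofFn f)
  have key : ev ∘ₗ gamEmb F V =
      ev ∘ₗ PiTensorProduct.lift (iterPrec (letters F V) n.1) ∘ₗ (symTensors F V n.1).subtype ∘ₗ
        DirectSum.component F _ (fun n : {n : ℕ // 0 < n} => symTensors F V n.1) n := by
    refine DirectSum.linearMap_ext F fun m => LinearMap.ext fun s => ?_
    simp only [LinearMap.comp_apply]
    rw [DirectSum.lof_eq_of, gamEmb, gamLift_of]
    by_cases hmn : m = n
    · subst hmn
      rw [← DirectSum.lof_eq_of F, DirectSum.component.lof_self]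
      rfl
    · rw [← DirectSum.lof_eq_of F, DirectSum.component.of, dif_neg hmn, map_zero, map_zero,
        map_zero]
      generalize s.1 = s
      have hz : ev ∘ₗ PiTensorProduct.lift (iterPrec (letters F V) m.1) = 0 := by
        refine PiTensorProduct.ext ?_
        ext v
        change PiTensorProduct.lift (iterPrec (letters F V) m.1) (PiTensorProduct.tprod F v)
          (List.ofFn f) = 0
        rw [PiTensorProduct.lift.tprod]
        exact iterPrec_letters_of_length_ne _ _ _ (by
          rw [List.length_ofFn]
          exact fun h => hmn (Subtype.ext h.symm))
      exact LinearMap.congr_fun hz s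
  exact (LinearMap.congr_fun key s).symm.trans
    ((congrArg ev hst).trans (LinearMap.congr_fun key t))

end Embedding

end

/-! ### Divided power monomials span the symmetric tensors -/

noncomputable section

section Spanning

variable {F V : Type u} [Field F] [AddCommGroup V] [Module F V]

theorem dpMonomial_eq_of {ι : Type} [Fintype ι] [DecidableEq ι] (v : ι → V) (r : ι → ℕ) {m : ℕ}
    (hr : ∑ i, r i = m) (hm : 0 < m) (t : symTensors F V m)
    (s : Finset (Fin m → ι))
    (hs : ∀ w, w ∈ s ↔ ∀ i, (Finset.univ.filter fun k => w k = i).card = r i)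
    (ht : t.1 = ∑ w ∈ s, PiTensorProduct.tprod F fun k => v (w k)) :
    dpMonomial v r = DirectSum.of (fun n : {n : ℕ // 0 < n} => symTensors F V n.1) ⟨m, hm⟩ t := by
  subst hr
  obtain rfl : s = words r := by
    ext w
    rw [hs, words, Finset.mem_filter]
    simp
  rw [dpMonomial, dif_pos hm]
  congr 1
  exact Subtype.ext ht.symm

/-- Two words in which every letter occurs equally often are rearrangements of each other. -/
theorem exists_perm_of_card_fiber_eq {n : ℕ} {I : Type*} [DecidableEq I] (p q : Fin n → I)
    (h : ∀ i, (Finset.univ.filter fun k => q k = i).card =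
      (Finset.univ.filter fun k => p k = i).card) : ∃ σ : Equiv.Perm (Fin n), q = p ∘ σ := by
  have e : ∀ i, Nonempty ({k // q k = i} ≃ {k // p k = i}) := fun i =>
    ⟨Fintype.equivOfCardEq (by rw [Fintype.card_subtype, Fintype.card_subtype, h i])⟩
  refine ⟨(Equiv.sigmaFiberEquiv q).symm.trans
    ((Equiv.sigmaCongrRight fun i => (e i).some).trans (Equiv.sigmaFiberEquiv p)), ?_⟩
  ext k
  exact ((e (q k)).some ⟨k, rfl⟩).2.symm

open Classical in
/-- The rearrangements of a word. -/
def rearrangements {n : ℕ} {I : Type*} (p : Fin n → I) : Finset (Fin n → I) :=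
  Finset.univ.image fun σ : Equiv.Perm (Fin n) => p ∘ σ

theorem mem_rearrangements {n : ℕ} {I : Type*} {p q : Fin n → I} :
    q ∈ rearrangements p ↔ ∃ σ : Equiv.Perm (Fin n), p ∘ σ = q := by
  simp [rearrangements]

/-- The sum of the rearrangements of a pure tensor is a divided power monomial, whose letters are
the distinct entries of the word. -/
theorem exists_dpMonomial_eq_sum_rearrangements {n : ℕ} (hn : 0 < n) {I : Type*} (b : I → V)
    (p : Fin n → I) :
    ∃ (k : ℕ) (v : Fin k → V) (r : Fin k → ℕ), 0 < k ∧ (∀ i, v i ∈ Set.range b) ∧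
      (∀ i, 0 < r i) ∧ ∀ t : symTensors F V n,
        t.1 = ∑ q ∈ rearrangements p, PiTensorProduct.tprod F (fun j => b (q j)) →
        DirectSum.of (fun n : {n : ℕ // 0 < n} => symTensors F V n.1) ⟨n, hn⟩ t =
          dpMonomial v r := by
  classical
  let e : {x // x ∈ Finset.univ.image p} ≃ Fin (Finset.univ.image p).card :=
    (Finset.univ.image p).equivFin
  have hcard : ∀ (w : Fin n → Fin (Finset.univ.image p).card) (i),
      (Finset.univ.filter fun j => w j = i) =
        Finset.univ.filter fun j => ((e.symm (w j) : {x // x ∈ Finset.univ.image p}) : I) =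
          (e.symm i : {x // x ∈ Finset.univ.image p}) := fun w i => by
    ext j
    simp
  refine ⟨(Finset.univ.image p).card, fun i => b (e.symm i).1,
    fun i => (Finset.univ.filter fun j => p j = (e.symm i).1).card, ?_, fun i => ⟨_, rfl⟩,
    fun i => ?_, fun t ht => (dpMonomial_eq_of _ _ ?_ hn t
      (Finset.univ.filter fun w => ∀ i, (Finset.univ.filter fun j => w j = i).card =
        (Finset.univ.filter fun j => p j = (e.symm i).1).card) (fun w => by simp)
      (ht.trans ?_)).symm⟩
  · exact Finset.card_pos.2 ⟨p ⟨0, hn⟩, Finset.mem_image_of_mem _ (Finset.mem_univ _)⟩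
  · obtain ⟨j, -, hj⟩ := Finset.mem_image.1 (e.symm i).2
    exact Finset.card_pos.2 ⟨j, by simp [hj]⟩
  · rw [← Equiv.sum_comp e]
    simp only [Equiv.symm_apply_apply]
    rw [Finset.sum_coe_sort (Finset.univ.image p)
      (fun x => (Finset.univ.filter fun j => p j = x).card),
      ← Finset.card_eq_sum_card_image, Finset.card_univ, Fintype.card_fin]
  · symm
    refine Finset.sum_bij (fun w _ => fun j => ((e.symm (w j)).1)) ?_ ?_ ?_ ?_
    · intro w hw
      rw [Finset.mem_filter] at hw
      obtain ⟨σ, hσ⟩ := exists_perm_of_card_fiber_eq p (fun j => (e.symm (w j)).1) fun x => by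
        by_cases hx : x ∈ Finset.univ.image p
        · have := hw.2 (e ⟨x, hx⟩)
          rw [hcard] at this
          simpa using this
        · rw [Finset.filter_false_of_mem, Finset.filter_false_of_mem]
          · intro j _ hj
            exact hx (hj ▸ Finset.mem_image_of_mem _ (Finset.mem_univ _))
          · intro j _ hj
            exact hx (hj ▸ (e.symm (w j)).2)
      exact mem_rearrangements.2 ⟨σ, hσ.symm⟩
    · intro w _ w' _ h
      ext1 j
      exact e.symm.injective (Subtype.ext (congrFun h j))
    · intro q hq
      obtain ⟨σ, rfl⟩ := mem_rearrangements.1 hq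
      have hmem : ∀ j, p j ∈ Finset.univ.image p := fun j =>
        Finset.mem_image_of_mem _ (Finset.mem_univ _)
      refine ⟨fun j => e ⟨p (σ j), hmem _⟩, ?_, by ext; simp⟩
      rw [Finset.mem_filter]
      refine ⟨Finset.mem_univ _, fun i => ?_⟩
      rw [hcard]
      exact Finset.card_equiv σ (by simp)
    · intro w _
      rfl

/-- If `s` spans `V`, then the divided power monomials in elements of `s` span `Γ(V)`. -/
theorem span_dpMonomial (s : Set V) (hs : Submodule.span F s = ⊤) :
    Submodule.span F {x : Gam F V | ∃ (n : ℕ) (v : Fin n → V) (r : Fin n → ℕ),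
      0 < n ∧ (∀ i, v i ∈ s) ∧ (∀ i, 0 < r i) ∧ dpMonomial v r = x} = ⊤ := by
  classical
  set M := Submodule.span F {x : Gam F V | ∃ (n : ℕ) (v : Fin n → V) (r : Fin n → ℕ),
      0 < n ∧ (∀ i, v i ∈ s) ∧ (∀ i, 0 < r i) ∧ dpMonomial v r = x} with hM
  let b := Module.Basis.ofSpan hs.ge
  have hb : Set.range b ⊆ s := Module.Basis.ofSpan_subset hs.ge
  rw [eq_top_iff]
  rintro x -
  induction x using DirectSum.induction_on with
  | zero => exact M.zero_mem
  | add x y hx hy => exact M.add_mem hx hy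
  | of n t =>
    obtain ⟨n, hn⟩ := n
    let B := Basis.piTensorProduct (R := F) fun _ : Fin n => b
    have hB : ∀ p, B p = PiTensorProduct.tprod F fun j => b (p j) :=
      fun p => Basis.piTensorProduct_apply _ _
    -- the coefficients of a symmetric tensor are constant on rearrangement classes
    have hperm : ∀ (t : symTensors F V n) (σ : Equiv.Perm (Fin n)) p,
        B.repr t.1 (p ∘ σ) = B.repr t.1 p := by
      intro t σ p
      have h1 : B.coord (p ∘ σ) =
          B.coord p ∘ₗ (PiTensorProduct.reindex F (fun _ => V) σ).toLinearMap := by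
        refine B.ext fun q => ?_
        rw [LinearMap.comp_apply, hB q]
        change _ = B.coord p (PiTensorProduct.reindex F (fun _ => V) σ _)
        have h2 : PiTensorProduct.reindex F (fun _ => V) σ
            (PiTensorProduct.tprod F fun j => b (q j)) = B (q ∘ σ.symm) := by
          rw [hB]
          exact PiTensorProduct.reindex_tprod (R := F) σ _
        rw [h2, ← hB, B.coord_apply, B.coord_apply, B.repr_self, B.repr_self,
          Finsupp.single_apply, Finsupp.single_apply]
        refine if_congr ?_ rfl rfl
        constructor
        · rintro rfl
          ext j
          simp
        · rintro rfl
          ext j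
          simp
      have h3 := LinearMap.congr_fun h1 t.1
      have h4 := t.2 σ
      rw [LinearMap.comp_apply] at h3
      change _ = B.coord p (PiTensorProduct.reindex F (fun _ => V) σ t.1) at h3
      rw [h4] at h3
      exact h3
    induction hN : (B.repr t.1).support.card using Nat.strong_induction_on generalizing t with
    | _ N ih =>
    by_cases h0 : t = 0
    · subst h0
      rw [map_zero]
      exact M.zero_mem
    obtain ⟨p, hp⟩ : ∃ p, B.repr t.1 p ≠ 0 := by
      by_contra hcon
      push Not at hcon
      refine h0 (Subtype.ext (B.ext_elem fun p => ?_))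
      rw [hcon p]
      simp
    let o : ⨂[F]^n V := ∑ q ∈ rearrangements p, B q
    have ho : o ∈ symTensors F V n := by
      intro σ
      change PiTensorProduct.reindex F (fun _ => V) σ (∑ q ∈ rearrangements p, B q) =
        ∑ q ∈ rearrangements p, B q
      rw [map_sum]
      refine Finset.sum_bij' (fun q _ => q ∘ σ.symm) (fun q _ => q ∘ σ) ?_ ?_ ?_ ?_ ?_
      · intro q hq
        obtain ⟨τ, rfl⟩ := mem_rearrangements.1 hq
        exact mem_rearrangements.2 ⟨σ.symm.trans τ, rfl⟩
      · intro q hq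
        obtain ⟨τ, rfl⟩ := mem_rearrangements.1 hq
        exact mem_rearrangements.2 ⟨σ.trans τ, rfl⟩
      · intro q _; ext j; simp
      · intro q _; ext j; simp
      · intro q _
        rw [hB, hB]
        exact PiTensorProduct.reindex_tprod (R := F) σ _
    have hrepr : ∀ q, B.repr o q = if q ∈ rearrangements p then 1 else 0 := by
      intro q
      change B.repr (∑ q ∈ rearrangements p, B q) q = _
      rw [map_sum, Finsupp.finsetSum_apply]
      simp only [B.repr_self, Finsupp.single_apply]
      rw [Finset.sum_ite_eq' (rearrangements p) q]
    obtain ⟨k, v, r, hk, hv, hr, hdp⟩ :=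
      exists_dpMonomial_eq_sum_rearrangements (F := F) hn b p
    have hoM : DirectSum.of (fun n : {n : ℕ // 0 < n} => symTensors F V n.1) ⟨n, hn⟩ ⟨o, ho⟩ ∈ M := by
      rw [hdp ⟨o, ho⟩ (Finset.sum_congr rfl fun q _ => hB q)]
      exact Submodule.subset_span ⟨k, v, r, hk, fun i => hb (hv i), hr, rfl⟩
    -- subtracting the contribution of one rearrangement class shrinks the support
    let t' : symTensors F V n := t - B.repr t.1 p • ⟨o, ho⟩
    have ht' : ∀ q, B.repr t'.1 q = if q ∈ rearrangements p then 0 else B.repr t.1 q := by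
      intro q
      change B.repr (t.1 - B.repr t.1 p • o) q = _
      rw [map_sub, map_smul, Finsupp.sub_apply, Finsupp.smul_apply, hrepr]
      split_ifs with hq
      · obtain ⟨σ, rfl⟩ := mem_rearrangements.1 hq
        rw [hperm, smul_eq_mul, mul_one, sub_self]
      · rw [smul_zero, sub_zero]
    have hlt : (B.repr t'.1).support.card < N := by
      rw [← hN]
      refine Finset.card_lt_card ⟨fun q hq => ?_, fun h => ?_⟩
      · rw [Finsupp.mem_support_iff, ht'] at hq
        rw [Finsupp.mem_support_iff]
        intro h
        rw [h, ite_self] at hq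
        exact hq rfl
      · have hpp : p ∈ rearrangements p := mem_rearrangements.2 ⟨Equiv.refl _, rfl⟩
        have := h (Finsupp.mem_support_iff.2 hp)
        rw [Finsupp.mem_support_iff, ht', if_pos hpp] at this
        exact this rfl
    have h1 := ih _ hlt t' rfl
    have h2 : t = t' + B.repr t.1 p • ⟨o, ho⟩ := (sub_add_cancel _ _).symm
    rw [h2, map_add]
    refine M.add_mem h1 ?_
    rw [← DirectSum.lof_eq_of F, map_smul, DirectSum.lof_eq_of]
    exact M.smul_mem _ hoM

/-- Linear maps out of `Γ(V)` that agree on divided power monomials are equal. -/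
theorem gam_hom_ext {M : Type*} [AddCommMonoid M] [Module F M] {f g : Gam F V →ₗ[F] M}
    (h : ∀ (n : ℕ) (v : Fin n → V) (r : Fin n → ℕ), 0 < n → (∀ i, 0 < r i) →
      f (dpMonomial v r) = g (dpMonomial v r)) : f = g := by
  refine LinearMap.ext_on (span_dpMonomial Set.univ Submodule.span_univ) ?_
  rintro _ ⟨n, v, r, hn, -, hr, rfl⟩
  exact h n v r hn hr

/-- A linear map out of `Γ(V)` takes values in a submodule if it does so on divided power
monomials. -/
theorem gam_forall_mem {M : Type*} [AddCommMonoid M] [Module F M] (f : Gam F V →ₗ[F] M)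
    (N : Submodule F M)
    (h : ∀ (n : ℕ) (v : Fin n → V) (r : Fin n → ℕ), 0 < n → (∀ i, 0 < r i) →
      f (dpMonomial v r) ∈ N) (x : Gam F V) : f x ∈ N := by
  have hx : x ∈ Submodule.span F _ :=
    (span_dpMonomial (F := F) (V := V) Set.univ Submodule.span_univ).ge Submodule.mem_top
  refine (Submodule.span_le (p := N.comap f)).2 ?_ hx
  rintro _ ⟨n, v, r, hn, -, hr, rfl⟩
  exact h n v r hn hr

/-- The divided power monomials in divided power monomials span `Γ(Γ(V))`. -/
theorem span_dpMonomial_dpMonomial :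
    Submodule.span F {x : Gam F (Gam F V) | ∃ (p : ℕ) (k : Fin p → ℕ) (r : Fin p → ℕ)
      (v : ∀ i, Fin (k i) → V) (q : ∀ i, Fin (k i) → ℕ), 0 < p ∧ (∀ i, 0 < k i) ∧
        (∀ i, 0 < r i) ∧ (∀ i j, 0 < q i j) ∧
        dpMonomial (fun i => dpMonomial (v i) (q i)) r = x} = ⊤ := by
  rw [eq_top_iff, ← span_dpMonomial _ (span_dpMonomial (F := F) (V := V) Set.univ
    Submodule.span_univ)]
  refine Submodule.span_mono ?_
  rintro _ ⟨p, w, r, hp, hw, hr, rfl⟩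
  choose k v q hk _ hq hdp using hw
  exact ⟨p, k, r, v, q, hp, hk, hr, hq, by simp only [hdp]⟩

theorem gam_gam_hom_ext {M : Type*} [AddCommMonoid M] [Module F M]
    {f g : Gam F (Gam F V) →ₗ[F] M}
    (h : ∀ (p : ℕ) (k : Fin p → ℕ) (r : Fin p → ℕ) (v : ∀ i, Fin (k i) → V)
      (q : ∀ i, Fin (k i) → ℕ), 0 < p → (∀ i, 0 < k i) → (∀ i, 0 < r i) → (∀ i j, 0 < q i j) →
      f (dpMonomial (fun i => dpMonomial (v i) (q i)) r) =
        g (dpMonomial (fun i => dpMonomial (v i) (q i)) r)) : f = g := by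
  refine LinearMap.ext_on span_dpMonomial_dpMonomial ?_
  rintro _ ⟨p, k, r, v, q, hp, hk, hr, hq, rfl⟩
  exact h p k r v q hp hk hr hq

theorem gam_gam_forall_mem {M : Type*} [AddCommMonoid M] [Module F M]
    (f : Gam F (Gam F V) →ₗ[F] M) (N : Submodule F M)
    (h : ∀ (p : ℕ) (k : Fin p → ℕ) (r : Fin p → ℕ) (v : ∀ i, Fin (k i) → V)
      (q : ∀ i, Fin (k i) → ℕ), 0 < p → (∀ i, 0 < k i) → (∀ i, 0 < r i) → (∀ i j, 0 < q i j) →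
      f (dpMonomial (fun i => dpMonomial (v i) (q i)) r) ∈ N) (x : Gam F (Gam F V)) :
    f x ∈ N := by
  have hx : x ∈ Submodule.span F _ :=
    (span_dpMonomial_dpMonomial (F := F) (V := V)).ge Submodule.mem_top
  refine (Submodule.span_le (p := N.comap f)).2 ?_ hx
  rintro _ ⟨p, k, r, v, q, hp, hk, hr, hq, rfl⟩
  exact h p k r v q hp hk hr hq

end Spanning

end

noncomputable section

open WordSeries

/-! ### The multiplication -/

section Multiplication

variable {F V W : Type u} [Field F] [AddCommGroup V] [Module F V] [AddCommGroup W] [Module F W]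
variable {I R : Type*} [CommRing R] [Algebra F R]

/-- The factorization of a linear map through the embedding `Γ(V) → WordSeries`. -/
def gamFactor {M : Type*} [AddCommMonoid M] [Module F M]
    (f : M →ₗ[F] WordSeries (Module.Dual F V) F)
    (h : ∀ x, f x ∈ LinearMap.range (gamEmb F V)) : M →ₗ[F] Gam F V :=
  (LinearEquiv.ofInjective (gamEmb F V) gamEmb_injective).symm.toLinearMap ∘ₗ
    f.codRestrict (LinearMap.range (gamEmb F V)) h

theorem gamEmb_gamFactor {M : Type*} [AddCommMonoid M] [Module F M]
    (f : M →ₗ[F] WordSeries (Module.Dual F V) F)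
    (h : ∀ x, f x ∈ LinearMap.range (gamEmb F V)) (x : M) :
    gamEmb F V (gamFactor f h x) = f x :=
  congrArg Subtype.val ((LinearEquiv.ofInjective (gamEmb F V) gamEmb_injective).apply_symm_apply
    (f.codRestrict (LinearMap.range (gamEmb F V)) h x))

theorem sum_pos_of_forall_pos {n : ℕ} (hn : 0 < n) {r : Fin n → ℕ} (hr : ∀ i, 0 < r i) :
    0 < ∑ i, r i :=
  (hr ⟨0, hn⟩).trans_le (Finset.single_le_sum (fun i _ => Nat.zero_le (r i)) (Finset.mem_univ _))

theorem gamLift_gamLift_dpMonomial (ψ : V →ₗ[F] WordSeries I R) {p : ℕ} (k r : Fin p → ℕ)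
    (v : ∀ i, Fin (k i) → V) (q : ∀ i, Fin (k i) → ℕ) (hp : 0 < p) (hk : ∀ i, 0 < k i)
    (hr : ∀ i, 0 < r i) (hq : ∀ i j, 0 < q i j) :
    gamLift (gamLift ψ) (dpMonomial (fun i => dpMonomial (v i) (q i)) r) =
      gamLift ψ (((∏ i, mulCoeff (r i) (q i) : ℕ) : F) •
        dpMonomial (fun ij : Σ i, Fin (k i) => v ij.1 ij.2) (fun ij => r ij.1 * q ij.1 ij.2)) := by
  have hpos : 0 < ∑ ij : Σ i, Fin (k i), r ij.1 * q ij.1 ij.2 := by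
    rw [Fintype.sum_sigma]
    exact sum_pos_of_forall_pos hp fun i =>
      sum_pos_of_forall_pos (hk i) fun j => Nat.mul_pos (hr i) (hq i j)
  have h : ∀ i, dpow (r i) (gamLift ψ (dpMonomial (v i) (q i))) =
      (mulCoeff (r i) (q i) : ℕ) * ∏ j, dpow (r i * q i j) (ψ (v i j)) := fun i => by
    rw [gamLift_dpMonomial _ _ _ (sum_pos_of_forall_pos (hk i) (hq i)),
      dpow_prod_dpow _ (hk i) _ _ (hq i)]
  rw [gamLift_dpMonomial _ _ _ (sum_pos_of_forall_pos hp hr), map_smul,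
    gamLift_dpMonomial _ _ _ hpos, Fintype.prod_sigma, Nat.cast_smul_eq_nsmul, nsmul_eq_mul,
    Nat.cast_prod, ← Finset.prod_mul_distrib]
  exact Finset.prod_congr rfl fun i _ => h i

variable (F V) in
/-- The multiplication `Γ(Γ(V)) → Γ(V)`, obtained from the divided powers of the shuffle algebra. -/
def gamMul : Gam F (Gam F V) →ₗ[F] Gam F V :=
  gamFactor (gamLift (gamEmb F V)) <| gam_gam_forall_mem _ _ fun _ k r v q hp hk hr hq =>
    ⟨_, (gamLift_gamLift_dpMonomial (letters F V) k r v q hp hk hr hq).symm⟩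

theorem gamEmb_gamMul (x : Gam F (Gam F V)) :
    gamEmb F V (gamMul F V x) = gamLift (gamEmb F V) x :=
  gamEmb_gamFactor _ _ x

theorem isGamMul_gamMul : IsGamMul (gamMul F V) := fun _ k r v q hp hk hr hq =>
  gamEmb_injective ((gamEmb_gamMul _).trans
    (gamLift_gamLift_dpMonomial (letters F V) k r v q hp hk hr hq))

theorem IsGamMul.eq {m m' : Gam F (Gam F V) →ₗ[F] Gam F V} (h : IsGamMul m) (h' : IsGamMul m') :
    m = m' :=
  gam_gam_hom_ext fun p k r v q hp hk hr hq =>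
    (h p k r v q hp hk hr hq).trans (h' p k r v q hp hk hr hq).symm

/-- The defining property of the multiplication: it evaluates divided powers of divided powers in
the shuffle algebra. -/
theorem gamLift_comp_gamMul (ψ : V →ₗ[F] WordSeries I R) :
    gamLift ψ ∘ₗ gamMul F V = gamLift (gamLift ψ) :=
  gam_gam_hom_ext fun p k r v q hp hk hr hq => by
    rw [LinearMap.comp_apply, isGamMul_gamMul p k r v q hp hk hr hq,
      gamLift_gamLift_dpMonomial ψ k r v q hp hk hr hq]

/-- To compare two maps into `Γ(V)`, it suffices to do so in the shuffle algebra. -/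
theorem gamEmb_comp_injective {M : Type*} [AddCommMonoid M] [Module F M] {f g : M →ₗ[F] Gam F V}
    (h : gamEmb F V ∘ₗ f = gamEmb F V ∘ₗ g) : f = g :=
  LinearMap.ext fun x => gamEmb_injective (LinearMap.congr_fun h x)

-- Unfolding these to tensors makes unification at `Γ(Γ(V))` prohibitively slow.
attribute [local irreducible] gamLift gamMul gamMap gamUnit symTensors iterPrec letters

theorem gamMul_naturality (f : V →ₗ[F] W) :
    gamMap f ∘ₗ gamMul F V = gamMul F W ∘ₗ gamMap (gamMap f) := by
  refine gamEmb_comp_injective ?_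
  rw [← LinearMap.comp_assoc, ← LinearMap.comp_assoc, gamEmb, gamLift_comp_gamMap,
    gamLift_comp_gamMul, gamLift_comp_gamMul, gamLift_comp_gamMap, gamLift_comp_gamMap]

theorem gamMul_assoc :
    gamMul F V ∘ₗ gamMap (gamMul F V) = gamMul F V ∘ₗ gamMul F (Gam F V) := by
  have h₁ : gamLift (letters F V) ∘ₗ gamMul F V = gamLift (gamLift (letters F V)) :=
    gamLift_comp_gamMul _
  have h₂ := gamLift_comp_gamMap (V := Gam F (Gam F V)) (W := Gam F V)
    (gamLift (letters F V)) (gamMul F V)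
  have h₃ : gamLift (gamLift (letters F V)) ∘ₗ gamMul F (Gam F V) =
      gamLift (gamLift (gamLift (letters F V))) :=
    gamLift_comp_gamMul (V := Gam F V) (gamLift (letters F V))
  refine LinearMap.ext fun x => gamEmb_injective ?_
  refine (LinearMap.congr_fun h₁ (gamMap (gamMul F V) x)).trans ?_
  refine Eq.trans ?_ (LinearMap.congr_fun h₁ (gamMul F (Gam F V) x)).symm
  exact (LinearMap.congr_fun h₂ x).trans
    ((congrArg (fun ψ => gamLift ψ x) h₁).trans (LinearMap.congr_fun h₃ x).symm)

theorem gamMul_left_unit : gamMul F V ∘ₗ gamUnit F (Gam F V) = LinearMap.id := by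
  refine gamEmb_comp_injective ?_
  rw [← LinearMap.comp_assoc, gamEmb, gamLift_comp_gamMul, LinearMap.comp_id]
  exact gamLift_gamUnit (V := Gam F V) (ψ := gamLift (letters F V)) (gamLift_nil _)

theorem gamMul_right_unit : gamMul F V ∘ₗ gamMap (gamUnit F V) = LinearMap.id := by
  refine gamEmb_comp_injective ?_
  rw [← LinearMap.comp_assoc, gamEmb, gamLift_comp_gamMul, gamLift_comp_gamMap,
    LinearMap.comp_id]
  exact congrArg gamLift (gamLift_gamUnit letters_nil)

end Multiplication

/-! ### The derivative -/

section Derivative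

variable {F V W : Type u} [Field F] [AddCommGroup V] [Module F V] [AddCommGroup W] [Module F W]
variable {I R : Type*} [CommRing R] [Algebra F R]

/-- The linear map `α + ε β`. -/
def addEpsₗ {M : Type*} [AddCommMonoid M] [Module F M] (α β : M →ₗ[F] WordSeries I R) :
    M →ₗ[F] WordSeries I (DualNumber R) where
  toFun v := addEps (α v) (β v)
  map_add' v w := by rw [map_add, map_add]; rfl
  map_smul' c v := by rw [map_smul, map_smul]; rfl

/-- The derivative of `gamLift` at `α` in the direction `β`: the coefficient of `ε` in
`gamLift (α + ε β)`. -/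
def gamLiftDeriv (α β : V →ₗ[F] WordSeries I R) : Gam F V →ₗ[F] WordSeries I R :=
  epsPartₗ F ∘ₗ gamLift (addEpsₗ α β)

/-- Reducing modulo `ε` turns `gamLift (α + ε β)` into `gamLift α`. -/
theorem gamLift_addEpsₗ (α β : V →ₗ[F] WordSeries I R) :
    gamLift (addEpsₗ α β) = addEpsₗ (gamLift α) (gamLiftDeriv α β) := by
  have h : mapₗ (TrivSqZeroExt.fstHom F R R) ∘ₗ gamLift (addEpsₗ α β) = gamLift α := by
    rw [mapₗ_comp_gamLift]
    rfl
  rw [← h]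
  rfl

theorem gamLiftDeriv_dpMonomial (α : V →ₗ[F] WordSeries I R) {β : V →ₗ[F] WordSeries I R}
    (hβ : ∀ v, β v [] = 0) {n : ℕ} (hn : 0 < n) (v : Fin n → V) (r : Fin n → ℕ)
    (hr : ∀ i, 0 < r i) :
    gamLiftDeriv α β (dpMonomial v r) =
      ∑ i, (∏ k, dpow (Function.update r i (r i - 1) k) (α (v k))) * β (v i) := by
  rw [gamLiftDeriv, LinearMap.comp_apply,
    gamLift_dpMonomial _ _ _ (sum_pos_of_forall_pos hn hr), epsPartₗ_apply,
    epsPart_prod_dpow (fun i => addEpsₗ α β (v i)) (fun i => hβ (v i)) _ hr]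
  rfl

theorem gamLiftDeriv_zero (α : V →ₗ[F] WordSeries I R) : gamLiftDeriv α 0 = 0 :=
  gam_hom_ext fun n v r hn hr => by
    rw [gamLiftDeriv_dpMonomial α (fun _ => rfl) hn v r hr]
    simp

theorem gamLiftDeriv_add (α : V →ₗ[F] WordSeries I R) {β β' : V →ₗ[F] WordSeries I R}
    (hβ : ∀ v, β v [] = 0) (hβ' : ∀ v, β' v [] = 0) :
    gamLiftDeriv α (β + β') = gamLiftDeriv α β + gamLiftDeriv α β' :=
  gam_hom_ext fun n v r hn hr => by
    rw [LinearMap.add_apply, gamLiftDeriv_dpMonomial α hβ hn v r hr,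
      gamLiftDeriv_dpMonomial α hβ' hn v r hr, gamLiftDeriv_dpMonomial α (fun v => by
        rw [LinearMap.add_apply, WordSeries.add_apply, hβ, hβ', add_zero]) hn v r hr,
      ← Finset.sum_add_distrib]
    exact Finset.sum_congr rfl fun i _ => by rw [LinearMap.add_apply, mul_add]

theorem gamLiftDeriv_dpMonomial_eq {ψ : V × V →ₗ[F] WordSeries I R} (hψ : ∀ x, ψ x [] = 0) {n : ℕ}
    (hn : 0 < n) (v : Fin n → V) (r : Fin n → ℕ) (hr : ∀ i, 0 < r i) :
    gamLiftDeriv (ψ ∘ₗ LinearMap.inl F V V) (ψ ∘ₗ LinearMap.inr F V V) (dpMonomial v r) =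
      gamLift ψ (∑ i, dpMonomial
        (Fin.snoc (α := fun _ => V × V) (fun j => (v j, 0)) (0, v i) : Fin (n + 1) → V × V)
        (Fin.snoc (α := fun _ => ℕ) (Function.update r i (r i - 1)) 1 : Fin (n + 1) → ℕ)) := by
  rw [gamLiftDeriv_dpMonomial (ψ ∘ₗ LinearMap.inl F V V) (β := ψ ∘ₗ LinearMap.inr F V V)
    (fun v => hψ (0, v)) hn v r hr, map_sum]
  refine Finset.sum_congr rfl fun i _ => ?_
  rw [gamLift_dpMonomial, Fin.prod_univ_castSucc]
  · simp only [Fin.snoc_castSucc, Fin.snoc_last]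
    rw [dpow_one (hψ _)]
    rfl
  · rw [Fin.sum_univ_castSucc, Fin.snoc_last]
    omega

-- Unfolding these to tensors makes unification at `Γ(Γ(V))` prohibitively slow.
attribute [local irreducible] gamLift gamMul gamMap gamUnit symTensors iterPrec letters

variable (F V) in
/-- The derivative `Γ(V) → Γ(V × V)`. -/
def gamDeriv : Gam F V →ₗ[F] Gam F (V × V) :=
  gamFactor (gamLiftDeriv (letters F (V × V) ∘ₗ LinearMap.inl F V V)
    (letters F (V × V) ∘ₗ LinearMap.inr F V V)) <| gam_forall_mem _ _ fun _ v r hn hr =>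
      ⟨_, (gamLiftDeriv_dpMonomial_eq letters_nil hn v r hr).symm⟩

theorem isGamDeriv_gamDeriv : IsGamDeriv (gamDeriv F V) := fun _ v r hn hr =>
  gamEmb_injective ((gamEmb_gamFactor _ _ _).trans
    (gamLiftDeriv_dpMonomial_eq letters_nil hn v r hr))

theorem IsGamDeriv.eq {d d' : Gam F V →ₗ[F] Gam F (V × V)} (h : IsGamDeriv d)
    (h' : IsGamDeriv d') : d = d' :=
  gam_hom_ext fun n v r hn hr => (h n v r hn hr).trans (h' n v r hn hr).symm

/-- The derivative in the shuffle algebra is differentiation with respect to `ε`. -/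
theorem gamLift_comp_gamDeriv {ψ : V × V →ₗ[F] WordSeries I R} (hψ : ∀ x, ψ x [] = 0) :
    gamLift ψ ∘ₗ gamDeriv F V =
      gamLiftDeriv (ψ ∘ₗ LinearMap.inl F V V) (ψ ∘ₗ LinearMap.inr F V V) :=
  gam_hom_ext fun n v r hn hr => by
    rw [LinearMap.comp_apply, isGamDeriv_gamDeriv n v r hn hr,
      gamLiftDeriv_dpMonomial_eq hψ hn v r hr]

theorem gamEmb_comp_gamMap_comp_gamDeriv (f : V × V →ₗ[F] W) :
    gamEmb F W ∘ₗ gamMap f ∘ₗ gamDeriv F V =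
      gamLiftDeriv (letters F W ∘ₗ f ∘ₗ LinearMap.inl F V V)
        (letters F W ∘ₗ f ∘ₗ LinearMap.inr F V V) := by
  rw [← LinearMap.comp_assoc, gamEmb, gamLift_comp_gamMap,
    gamLift_comp_gamDeriv (ψ := letters F W ∘ₗ f) fun x => letters_nil _]
  rfl

theorem gamEmb_comp_gamDeriv :
    gamEmb F (V × V) ∘ₗ gamDeriv F V =
      gamLiftDeriv (letters F (V × V) ∘ₗ LinearMap.inl F V V)
        (letters F (V × V) ∘ₗ LinearMap.inr F V V) :=
  gamLift_comp_gamDeriv letters_nil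

theorem gamLiftDeriv_comp_gamMap (α β : W →ₗ[F] WordSeries I R) (f : V →ₗ[F] W) :
    gamLiftDeriv α β ∘ₗ gamMap f = gamLiftDeriv (α ∘ₗ f) (β ∘ₗ f) := by
  rw [gamLiftDeriv, LinearMap.comp_assoc, gamLift_comp_gamMap]
  rfl

theorem gamDeriv_naturality (f : V →ₗ[F] W) :
    gamDeriv F W ∘ₗ gamMap f = gamMap (f.prodMap f) ∘ₗ gamDeriv F V := by
  refine gamEmb_comp_injective ?_
  rw [gamEmb_comp_gamMap_comp_gamDeriv, ← LinearMap.comp_assoc, gamEmb_comp_gamDeriv,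
    gamLiftDeriv_comp_gamMap]
  congr 1
  · ext1 v; simp
  · ext1 v; simp

theorem gamDeriv_zero_rule : gamMap (LinearMap.fst F V V) ∘ₗ gamDeriv F V = 0 := by
  refine gamEmb_comp_injective ?_
  rw [gamEmb_comp_gamMap_comp_gamDeriv, LinearMap.fst_comp_inr, LinearMap.comp_zero,
    gamLiftDeriv_zero, LinearMap.comp_zero]

/-- The derivative is additive in the direction: here `f`, `g`, `h` agree on the base point, and the
direction of `f` is the sum of those of `g` and `h`. -/
theorem gamDeriv_additive_rule (f g h : V × V →ₗ[F] W)
    (hfg : f ∘ₗ LinearMap.inl F V V = g ∘ₗ LinearMap.inl F V V)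
    (hfh : f ∘ₗ LinearMap.inl F V V = h ∘ₗ LinearMap.inl F V V)
    (hadd : f ∘ₗ LinearMap.inr F V V = g ∘ₗ LinearMap.inr F V V + h ∘ₗ LinearMap.inr F V V) :
    gamMap f ∘ₗ gamDeriv F V = gamMap g ∘ₗ gamDeriv F V + gamMap h ∘ₗ gamDeriv F V := by
  refine gamEmb_comp_injective ?_
  rw [LinearMap.comp_add, gamEmb_comp_gamMap_comp_gamDeriv, gamEmb_comp_gamMap_comp_gamDeriv,
    gamEmb_comp_gamMap_comp_gamDeriv, hadd, LinearMap.comp_add, ← hfg, ← hfh,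
    gamLiftDeriv_add _ (β := letters F W ∘ₗ g ∘ₗ LinearMap.inr F V V)
      (β' := letters F W ∘ₗ h ∘ₗ LinearMap.inr F V V) (fun v => letters_nil _)
      (fun v => letters_nil _)]

theorem gamLiftDeriv_comp_gamUnit (α : V →ₗ[F] WordSeries I R) {β : V →ₗ[F] WordSeries I R}
    (hβ : ∀ v, β v [] = 0) : gamLiftDeriv α β ∘ₗ gamUnit F V = β := by
  ext1 v
  rw [LinearMap.comp_apply, gamUnit_apply,
    gamLiftDeriv_dpMonomial α hβ one_pos _ _ (fun _ => one_pos)]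
  simp

theorem gamDeriv_linear_rule :
    gamDeriv F V ∘ₗ gamUnit F V = gamUnit F (V × V) ∘ₗ LinearMap.inr F V V := by
  refine gamEmb_comp_injective ?_
  rw [← LinearMap.comp_assoc, ← LinearMap.comp_assoc, gamEmb_comp_gamDeriv, gamEmb,
    gamLift_gamUnit letters_nil,
    gamLiftDeriv_comp_gamUnit _ (β := letters F (V × V) ∘ₗ LinearMap.inr F V V)
      fun v => letters_nil _]

/-- The chain rule: both sides are the coefficient of `ε` in `gamLift (gamLift (α + ε β))`. -/
theorem gamDeriv_chain_rule :
    gamDeriv F V ∘ₗ gamMul F V =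
      gamMul F (V × V) ∘ₗ gamMap ((gamMap (LinearMap.inl F V V)).coprod (gamDeriv F V)) ∘ₗ
        gamDeriv F (Gam F V) := by
  refine gamEmb_comp_injective ?_
  rw [← LinearMap.comp_assoc, ← LinearMap.comp_assoc, gamEmb_comp_gamDeriv, gamLiftDeriv,
    LinearMap.comp_assoc, gamLift_comp_gamMul, gamLift_addEpsₗ, ← gamLiftDeriv, gamEmb,
    gamLift_comp_gamMul, ← LinearMap.comp_assoc, gamLift_comp_gamMap,
    gamLift_comp_gamDeriv fun x => gamLift_nil _ _, LinearMap.comp_assoc, LinearMap.comp_assoc,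
    LinearMap.coprod_inl, LinearMap.coprod_inr, gamLift_comp_gamMap,
    gamLift_comp_gamDeriv letters_nil]

/-- The second derivative of `gamLift` at `α` in the directions `β`, `β'`, with second order
term `κ`: the coefficient of `ε ε'` in `gamLift (α + ε β + ε' β' + ε ε' κ)`. -/
def gamLiftDeriv₂ (α β β' κ : V →ₗ[F] WordSeries I R) : Gam F V →ₗ[F] WordSeries I R :=
  epsPartₗ F ∘ₗ epsPartₗ F ∘ₗ gamLift (addEpsₗ (addEpsₗ α β) (addEpsₗ β' κ))

theorem gamLift_comp_gamDeriv_comp_gamDeriv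
    {ψ : (V × V) × (V × V) →ₗ[F] WordSeries I R} (hψ : ∀ x, ψ x [] = 0) :
    gamLift ψ ∘ₗ gamDeriv F (V × V) ∘ₗ gamDeriv F V =
      gamLiftDeriv₂ (ψ ∘ₗ LinearMap.inl F _ _ ∘ₗ LinearMap.inl F V V)
        (ψ ∘ₗ LinearMap.inr F _ _ ∘ₗ LinearMap.inl F V V)
        (ψ ∘ₗ LinearMap.inl F _ _ ∘ₗ LinearMap.inr F V V)
        (ψ ∘ₗ LinearMap.inr F _ _ ∘ₗ LinearMap.inr F V V) := by
  rw [← LinearMap.comp_assoc, gamLift_comp_gamDeriv hψ, gamLiftDeriv, LinearMap.comp_assoc,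
    gamLift_comp_gamDeriv fun x => addEps_nil (hψ _) (hψ _)]
  rfl

/-- The dual number `a + ε b`. -/
def dualMk {R : Type*} (a b : R) : DualNumber R := (a, b)

@[simp] theorem fst_dualMk {R : Type*} (a b : R) : (dualMk a b).fst = a := rfl

@[simp] theorem snd_dualMk {R : Type*} (a b : R) : (dualMk a b).snd = b := rfl

/-- The exchange of `ε` and `ε'` in `R[ε][ε']`, where `ε` is the inner dual number. -/
def epsSwap (F R : Type*) [CommRing F] [CommRing R] [Algebra F R] :
    DualNumber (DualNumber R) →ₐ[F] DualNumber (DualNumber R) where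
  toFun x := dualMk (dualMk x.fst.fst x.snd.fst) (dualMk x.fst.snd x.snd.snd)
  map_one' := rfl
  map_zero' := rfl
  map_add' _ _ := rfl
  map_mul' x y := by
    refine TrivSqZeroExt.ext (TrivSqZeroExt.ext ?_ ?_) (TrivSqZeroExt.ext ?_ ?_)
    · simp
    · simp
    · simp
    · simp
      ring
  commutes' _ := rfl

/-- The homomorphism `R[ε] → R[ε][ε']` with `ε ↦ ε ε'`. -/
def epsMul (F R : Type*) [CommRing F] [CommRing R] [Algebra F R] :
    DualNumber R →ₐ[F] DualNumber (DualNumber R) where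
  toFun x := dualMk (dualMk x.fst 0) (dualMk 0 x.snd)
  map_one' := rfl
  map_zero' := rfl
  map_add' x y := by
    refine TrivSqZeroExt.ext (TrivSqZeroExt.ext ?_ ?_) (TrivSqZeroExt.ext ?_ ?_)
    · rfl
    · exact (add_zero _).symm
    · exact (add_zero _).symm
    · rfl
  map_mul' x y := by
    refine TrivSqZeroExt.ext (TrivSqZeroExt.ext ?_ ?_) (TrivSqZeroExt.ext ?_ ?_)
    · simp
    · simp
    · simp
    · simp
  commutes' _ := rfl

/-- The second derivative is symmetric in the directions, by the exchange of `ε` and `ε'`. -/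
theorem gamLiftDeriv₂_swap (α β β' κ : V →ₗ[F] WordSeries I R) :
    gamLiftDeriv₂ α β β' κ = gamLiftDeriv₂ α β' β κ := by
  have h := mapₗ_comp_gamLift (addEpsₗ (addEpsₗ α β) (addEpsₗ β' κ)) (S := DualNumber (DualNumber R))
    (epsSwap F R)
  have h2 : mapₗ (epsSwap F R) ∘ₗ addEpsₗ (addEpsₗ α β) (addEpsₗ β' κ) =
      addEpsₗ (addEpsₗ α β') (addEpsₗ β κ) := rfl
  rw [gamLiftDeriv₂, gamLiftDeriv₂, ← h2, ← h]
  rfl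

/-- Without first order terms, only the derivative along the second order term remains, by the
substitution of `ε ε'` for `ε`. -/
theorem gamLiftDeriv₂_zero_zero (α κ : V →ₗ[F] WordSeries I R) :
    gamLiftDeriv₂ α 0 0 κ = gamLiftDeriv α κ := by
  have h := mapₗ_comp_gamLift (addEpsₗ α κ) (S := DualNumber (DualNumber R)) (epsMul F R)
  have h2 : mapₗ (epsMul F R) ∘ₗ addEpsₗ α κ = addEpsₗ (addEpsₗ α 0) (addEpsₗ 0 κ) := rfl
  rw [gamLiftDeriv₂, gamLiftDeriv, ← h2, ← h]
  rfl

/-- The lift rule. Precomposition with the lifting map annihilates both first order directions. -/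
theorem gamDeriv_lift_rule :
    gamMap ((LinearMap.fst F V V).prodMap (LinearMap.snd F V V)) ∘ₗ
      gamDeriv F (V × V) ∘ₗ gamDeriv F V = gamDeriv F V := by
  refine gamEmb_comp_injective ?_
  rw [← LinearMap.comp_assoc, gamEmb, gamLift_comp_gamMap,
    gamLift_comp_gamDeriv_comp_gamDeriv (ψ := letters F (V × V) ∘ₗ
      (LinearMap.fst F V V).prodMap (LinearMap.snd F V V)) fun x => letters_nil _,
    gamLift_comp_gamDeriv letters_nil,
    ← gamLiftDeriv₂_zero_zero]
  congr 1
  · ext1 v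
    exact map_zero (letters F (V × V))
  · ext1 v
    exact map_zero (letters F (V × V))

/-- The symmetry rule. The interchange `c` swaps the two directions of the second derivative. -/
theorem gamDeriv_symmetry_rule (c : (V × V) × (V × V) →ₗ[F] (V × V) × (V × V))
    (hc : ∀ x, c x = ((x.1.1, x.2.1), (x.1.2, x.2.2))) :
    gamMap c ∘ₗ gamDeriv F (V × V) ∘ₗ gamDeriv F V = gamDeriv F (V × V) ∘ₗ gamDeriv F V := by
  refine gamEmb_comp_injective ?_
  rw [← LinearMap.comp_assoc, gamEmb, gamLift_comp_gamMap,
    gamLift_comp_gamDeriv_comp_gamDeriv (ψ := letters F _ ∘ₗ c) fun x => letters_nil _,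
    gamLift_comp_gamDeriv_comp_gamDeriv letters_nil, gamLiftDeriv₂_swap]
  congr 1
  all_goals
    ext1 v
    simp only [LinearMap.comp_apply, LinearMap.inl_apply, LinearMap.inr_apply, hc]
    rfl

end Derivative

/-! ### The linear part -/

section Counit

variable {F V W : Type u} [Field F] [AddCommGroup V] [Module F V] [AddCommGroup W] [Module F W]

variable (F V) in
/-- The projection of `Γ(V)` to `Γ₁(V) = V`. -/
def gamCounit : Gam F V →ₗ[F] V :=
  (PiTensorProduct.subsingletonEquiv (R := F) (s := fun _ : Fin 1 => V) 0).toLinearMap ∘ₗ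
    (symTensors F V 1).subtype ∘ₗ
      DirectSum.component F _ (fun n : {n : ℕ // 0 < n} => symTensors F V n.1) ⟨1, one_pos⟩

theorem gamCounit_gamUnit (v : V) : gamCounit F V (gamUnit F V v) = v := by
  rw [gamCounit, gamUnit, LinearMap.comp_apply, LinearMap.comp_apply, LinearMap.comp_apply,
    DirectSum.component.lof_self]
  exact LinearEquiv.apply_symm_apply _ _

theorem isGamCounit_gamCounit : IsGamCounit (gamCounit F V) := by
  refine ⟨fun v => by rw [← gamUnit_apply, gamCounit_gamUnit], fun n v r hn hr h => ?_⟩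
  have hpos := sum_pos_of_forall_pos hn hr
  have hne : ∑ i, r i ≠ 1 := by
    intro h1
    have hle : ∑ _i : Fin n, 1 ≤ ∑ i, r i := Finset.sum_le_sum fun i _ => hr i
    have hn1 : n = 1 := by
      rw [h1] at hle
      simp at hle
      omega
    subst hn1
    refine h ⟨rfl, fun i => ?_⟩
    rw [Fin.sum_univ_one] at h1
    rwa [Subsingleton.elim i 0]
  rw [dpMonomial, dif_pos hpos, gamCounit, LinearMap.comp_apply, LinearMap.comp_apply,
    ← DirectSum.lof_eq_of F, DirectSum.component.of, dif_neg, map_zero, map_zero]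
  exact fun h1 => hne (congrArg Subtype.val h1)

theorem dpMonomial_fin_one (v : Fin 1 → V) (r : Fin 1 → ℕ) (hr : ∀ i, r i = 1) :
    dpMonomial (F := F) v r = gamUnit F V (v 0) := by
  rw [gamUnit_apply]
  congr 1
  · ext i; rw [Subsingleton.elim i 0]
  · ext i; exact hr i

theorem IsGamCounit.eq {e e' : Gam F V →ₗ[F] V} (h : IsGamCounit e) (h' : IsGamCounit e') :
    e = e' := by
  refine gam_hom_ext fun n v r hn hr => ?_
  by_cases hc : n = 1 ∧ ∀ i, r i = 1
  · obtain ⟨rfl, h1⟩ := hc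
    rw [dpMonomial_fin_one v r h1, gamUnit_apply, h.1, h'.1]
  · rw [h.2 n v r hn hr hc, h'.2 n v r hn hr hc]

theorem gamCounit_naturality (f : V →ₗ[F] W) :
    gamCounit F W ∘ₗ gamMap f = f ∘ₗ gamCounit F V := by
  refine gam_hom_ext fun n v r hn hr => ?_
  rw [LinearMap.comp_apply, LinearMap.comp_apply, gamMap_dpMonomial]
  by_cases hc : n = 1 ∧ ∀ i, r i = 1
  · obtain ⟨rfl, h1⟩ := hc
    rw [dpMonomial_fin_one _ r h1, dpMonomial_fin_one _ r h1, gamCounit_gamUnit, gamCounit_gamUnit]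
  · rw [isGamCounit_gamCounit.2 n _ r hn hr hc, isGamCounit_gamCounit.2 n _ r hn hr hc, map_zero]

theorem gamCounit_linearization_rule :
    gamUnit F V ∘ₗ gamCounit F V = gamMap (LinearMap.snd F V V) ∘ₗ gamDeriv F V := by
  refine gamEmb_comp_injective ?_
  rw [gamEmb_comp_gamMap_comp_gamDeriv, LinearMap.snd_comp_inl, LinearMap.snd_comp_inr,
    LinearMap.comp_zero, LinearMap.comp_id, ← LinearMap.comp_assoc, gamEmb,
    gamLift_gamUnit letters_nil]
  refine gam_hom_ext fun n v r hn hr => ?_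
  rw [LinearMap.comp_apply]
  by_cases hc : n = 1 ∧ ∀ i, r i = 1
  · obtain ⟨rfl, h1⟩ := hc
    rw [dpMonomial_fin_one v r h1, gamCounit_gamUnit, ← LinearMap.comp_apply,
      gamLiftDeriv_comp_gamUnit _ letters_nil]
  · rw [isGamCounit_gamCounit.2 n _ r hn hr hc, map_zero,
      gamLiftDeriv_dpMonomial _ letters_nil hn v r hr]
    refine (Finset.sum_eq_zero fun i _ => ?_).symm
    -- some factor other than the differentiated one remains
    obtain ⟨k, hk⟩ : ∃ k, 0 < Function.update r i (r i - 1) k := by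
      by_contra hcon
      push Not at hcon
      have hk : ∀ k, k = i := fun k => by
        by_contra hki
        have := hcon k
        rw [Function.update_of_ne hki] at this
        have := hr k
        omega
      have hri := hcon i
      rw [Function.update_self] at hri
      refine hc ⟨?_, fun k => ?_⟩
      · have h0 := hk ⟨0, hn⟩
        by_contra hn1
        have h1 := hk ⟨1, by omega⟩
        rw [← h0] at h1
        simp at h1
      · have := hr i
        rw [hk k]
        omega
    rw [Finset.prod_eq_zero (Finset.mem_univ k), zero_mul]
    exact dpow_zero_right hk

end Counit

end

/-! ### The coKleisli category of a Cartesian differential comonad -/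

section CoKleisli

variable {C : Type u} [Category.{v} C] {U : Comonad C}

variable (U) in
/-- A map of the base category as a coKleisli map. -/
abbrev cokleisliMap {A B : C} (f : A ⟶ B) : Cokleisli.mk U A ⟶ Cokleisli.mk U B :=
  (Cokleisli.Adjunction.toCokleisli U).map f

theorem cokleisliMap_comp_of {A B : C} {X : Cokleisli U} (f : A ⟶ B)
    (g : Cokleisli.mk U B ⟶ X) : (cokleisliMap U f ≫ g).of = U.map f ≫ g.of := by
  simp

theorem cokleisli_id (A : Cokleisli U) : 𝟙 A = cokleisliMap U (𝟙 A.of) :=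
  ((Cokleisli.Adjunction.toCokleisli U).map_id A.of).symm

variable [CartesianMonoidalCategory C]

theorem cokleisli_fst (A B : Cokleisli U) : fst A B = cokleisliMap U (fst A.of B.of) := rfl

theorem cokleisli_snd (A B : Cokleisli U) : snd A B = cokleisliMap U (snd A.of B.of) := rfl

theorem cokleisli_lift_map {X A B : C} (f : X ⟶ A) (g : X ⟶ B) :
    lift (cokleisliMap U f) (cokleisliMap U g) = cokleisliMap U (lift f g) :=
  Cokleisli.hom_ext U (comp_lift _ _ _).symm

theorem cokleisli_tensor_map {A B A' B' : C} (f : A ⟶ B) (g : A' ⟶ B') :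
    cokleisliMap U f ⊗ₘ cokleisliMap U g = cokleisliMap U (f ⊗ₘ g) := by
  apply CartesianMonoidalCategory.hom_ext
  · rw [tensorHom_fst, cokleisli_fst, cokleisli_fst]
    exact (Functor.map_comp _ _ _).symm.trans
      ((congrArg _ (tensorHom_fst f g).symm).trans (Functor.map_comp _ _ _))
  · rw [tensorHom_snd, cokleisli_snd, cokleisli_snd]
    exact (Functor.map_comp _ _ _).symm.trans
      ((congrArg _ (tensorHom_snd f g).symm).trans (Functor.map_comp _ _ _))

theorem cokleisli_interchangeMap (A : Cokleisli U) :
    interchangeMap A = cokleisliMap U (interchangeMap A.of) := by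
  rw [interchangeMap, cokleisli_fst, cokleisli_snd]
  exact (congrArg₂ _ (cokleisli_tensor_map _ _) (cokleisli_tensor_map _ _)).trans
    (cokleisli_lift_map _ _)

variable [Preadditive C]

theorem cokleisli_inj₀ (A B : Cokleisli U) :
    inj₀ A B = cokleisliMap U (inj₀ A.of B.of) := by
  have h : (0 : A ⟶ B) = cokleisliMap U (0 : A.of ⟶ B.of) :=
    Cokleisli.hom_ext U Limits.comp_zero.symm
  rw [inj₀, cokleisli_id, h]
  exact cokleisli_lift_map _ _

theorem cokleisli_inj₁ (A B : Cokleisli U) :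
    inj₁ A B = cokleisliMap U (inj₁ A.of B.of) := by
  have h : (0 : B ⟶ A) = cokleisliMap U (0 : B.of ⟶ A.of) :=
    Cokleisli.hom_ext U Limits.comp_zero.symm
  rw [inj₁, cokleisli_id, h]
  exact cokleisli_lift_map _ _

theorem cokleisli_sumMap (A : Cokleisli U) : sumMap A = cokleisliMap U (sumMap A.of) :=
  Cokleisli.hom_ext U (Preadditive.comp_add _ _ _ _ _ _).symm

theorem cokleisli_liftingMap (A : Cokleisli U) :
    liftingMap A = cokleisliMap U (liftingMap A.of) := by
  rw [liftingMap, cokleisli_inj₀, cokleisli_inj₁]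
  exact cokleisli_tensor_map _ _

/-- The differential combinator `D[f] = f ∘ ∂` of the coKleisli category. -/
def cokleisliDifferential (d : DifferentialCombinatorTransformation U) :
    DifferentialCombinator (Cokleisli U) where
  D {A B} f := ⟨d.app A.of ≫ f.of⟩
  D_add f g := Cokleisli.hom_ext U (Preadditive.comp_add _ _ _ _ _ _)
  D_zero A B := Cokleisli.hom_ext U Limits.comp_zero
  D_sumMap {A B} f := by
    rw [cokleisli_sumMap, cokleisli_id, cokleisli_fst, cokleisli_snd]
    refine Cokleisli.hom_ext U ?_
    erw [cokleisli_tensor_map, cokleisli_tensor_map, cokleisli_tensor_map]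
    refine (cokleisliMap_comp_of _ _).trans (Eq.trans ?_ (congrArg₂ (· + ·)
      (cokleisliMap_comp_of _ _).symm (cokleisliMap_comp_of _ _).symm))
    have h := d.additive_rule A.of
    rw [Preadditive.add_comp] at h
    have h2 := congrArg (· ≫ f.of) h
    simp only [Preadditive.add_comp, Category.assoc] at h2
    exact h2
  D_inj₀ {A B} f := by
    rw [cokleisli_inj₀]
    refine Cokleisli.hom_ext U ((cokleisliMap_comp_of _ _).trans ?_)
    have h := congrArg (· ≫ f.of) (d.zero_rule A.of)
    simp only [Limits.zero_comp, Category.assoc] at h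
    exact h
  D_id A := Cokleisli.hom_ext U (d.linear_rule A.of)
  D_fst A B := by
    refine Cokleisli.hom_ext U ?_
    have h := congrArg (· ≫ fst A.of B.of) (d.linear_rule (A.of ⊗ B.of))
    simp only [Category.assoc] at h
    refine h.trans ?_
    rw [cokleisli_snd, cokleisli_fst]
    exact (congrArg Cokleisli.Hom.of ((Cokleisli.Adjunction.toCokleisli U).map_comp _ _))
  D_snd A B := by
    refine Cokleisli.hom_ext U ?_
    have h := congrArg (· ≫ snd A.of B.of) (d.linear_rule (A.of ⊗ B.of))
    simp only [Category.assoc] at h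
    refine h.trans ?_
    rw [cokleisli_snd, cokleisli_snd]
    exact (congrArg Cokleisli.Hom.of ((Cokleisli.Adjunction.toCokleisli U).map_comp _ _))
  D_lift f g := Cokleisli.hom_ext U (comp_lift _ _ _)
  D_comp {A B X} f g := by
    refine Cokleisli.hom_ext U ?_
    have h : (fst A A ≫ f).of = U.map (fst A.of A.of) ≫ f.of := cokleisliMap_comp_of _ _
    change d.app A.of ≫ U.δ.app A.of ≫ U.map f.of ≫ g.of =
      U.δ.app (A.of ⊗ A.of) ≫ U.map (lift (fst A A ≫ f).of (d.app A.of ≫ f.of)) ≫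
        d.app B.of ≫ g.of
    rw [h, ← lift_map, U.map_comp, Category.assoc, ← Category.assoc (d.app A.of), d.chain_rule]
    simp only [Category.assoc]
    have hn := congrArg (· ≫ g.of) (d.naturality f.of)
    simp only [Category.assoc] at hn
    rw [hn]
  D_lifting {A B} f := by
    rw [cokleisli_liftingMap]
    refine Cokleisli.hom_ext U ((cokleisliMap_comp_of _ _).trans ?_)
    have h := congrArg (· ≫ f.of) (d.lift_rule A.of)
    simp only [Category.assoc] at h
    exact h
  D_interchange {A B} f := by
    rw [cokleisli_interchangeMap]
    refine Cokleisli.hom_ext U ((cokleisliMap_comp_of _ _).trans ?_)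
    have h := congrArg (· ≫ f.of) (d.symmetry_rule A.of)
    simp only [Category.assoc] at h
    exact h

theorem isLinear_cokleisliMap (d : DifferentialCombinatorTransformation U) {A B : C}
    (f : A ⟶ B) : (cokleisliDifferential d).IsLinear (cokleisliMap U f) := by
  refine Cokleisli.hom_ext U ?_
  have h := congrArg (· ≫ f) (d.linear_rule A)
  simp only [Category.assoc] at h
  refine h.trans ?_
  rw [cokleisli_snd]
  exact (congrArg Cokleisli.Hom.of ((Cokleisli.Adjunction.toCokleisli U).map_comp _ _))

/-- With a `D`-linear unit, a `D`-linear map is determined by its linear part. -/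
theorem DLinearUnit.counit_comp_app_comp {d : DifferentialCombinatorTransformation U}
    (e : DLinearUnit d) {A B : Cokleisli U} {f : A ⟶ B}
    (hf : (cokleisliDifferential d).IsLinear f) :
    U.ε.app A.of ≫ e.app A.of ≫ f.of = f.of := by
  have h : d.app A.of ≫ f.of = U.map (snd A.of A.of) ≫ f.of :=
    (congrArg Cokleisli.Hom.of hf).trans (cokleisliMap_comp_of _ _)
  rw [← Category.assoc, e.linearization_rule, Category.assoc, h, ← Category.assoc, ← U.map_comp,
    inj₁, lift_snd, U.map_id, Category.id_comp]

/-- The functor `f ↦ f ∘ ε` to the subcategory of `D`-linear maps. -/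
def toDLin (d : DifferentialCombinatorTransformation U) :
    C ⥤ (cokleisliDifferential d).DLin where
  obj A := ⟨Cokleisli.mk U A⟩
  map f := ⟨cokleisliMap U f, isLinear_cokleisliMap d f⟩
  map_id A := by
    exact WideSubcategory.hom_ext _ ((Cokleisli.Adjunction.toCokleisli U).map_id A)
  map_comp f g := by
    exact WideSubcategory.hom_ext _ ((Cokleisli.Adjunction.toCokleisli U).map_comp f g)

/-- The functor sending a `D`-linear map to its linear part. -/
def fromDLin {d : DifferentialCombinatorTransformation U} (e : DLinearUnit d) :
    (cokleisliDifferential d).DLin ⥤ C where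
  obj A := A.obj.of
  map {A B} f := e.app A.obj.of ≫ f.hom.of
  map_id A := e.linear_rule _
  map_comp {A B X} f g := by
    change e.app A.obj.of ≫ (f.hom ≫ g.hom).of = _
    have hg := e.counit_comp_app_comp g.property
    have h : (f.hom ≫ g.hom).of = f.hom.of ≫ e.app B.obj.of ≫ g.hom.of := by
      rw [← cokleisli_comp_base U f.hom.of, hg]
      rfl
    rw [h, Category.assoc]

theorem toDLin_comp_fromDLin {d : DifferentialCombinatorTransformation U} (e : DLinearUnit d) :
    toDLin d ⋙ fromDLin e = 𝟭 C :=
  Functor.hext (fun _ => rfl) fun A B f => heq_of_eq (by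
    change e.app A ≫ U.ε.app A ≫ f = f
    rw [← Category.assoc, e.linear_rule, Category.id_comp])

theorem fromDLin_comp_toDLin {d : DifferentialCombinatorTransformation U} (e : DLinearUnit d) :
    fromDLin e ⋙ toDLin d = 𝟭 _ :=
  Functor.hext (fun _ => rfl) fun _ _ f => heq_of_eq
    (WideSubcategory.hom_ext _ (Cokleisli.hom_ext U (e.counit_comp_app_comp f.property)))

end CoKleisli

/-! ### The Cartesian differential comonad of symmetric tensors -/

theorem coprod_inl_comp_inr_comp {R M N P Q : Type*} [Semiring R] [AddCommMonoid M]
    [AddCommMonoid N] [AddCommMonoid P] [AddCommMonoid Q] [Module R M] [Module R N] [Module R P]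
    [Module R Q] (f : M →ₗ[R] P) (g : N →ₗ[R] Q) :
    (LinearMap.inl R P Q ∘ₗ f).coprod (LinearMap.inr R P Q ∘ₗ g) = f.prodMap g :=
  LinearMap.ext fun _ => Prod.ext (add_zero _) (zero_add _)

noncomputable section

section VecOp

variable {F : Type u} [Field F]

-- Takes precedence over the monoidal structure on the opposite of the tensor category `F-VEC`.
local instance : MonoidalCategory (ModuleCat.{u} F)ᵒᵖ := (vecOpCartesian F).toMonoidalCategory

theorem vecOp_lift {X A B : (ModuleCat.{u} F)ᵒᵖ} (f : X ⟶ A) (g : X ⟶ B) :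
    (lift f g).unop.hom = f.unop.hom.coprod g.unop.hom := rfl

theorem vecOp_tensorHom {A B A' B' : (ModuleCat.{u} F)ᵒᵖ} (f : A ⟶ B) (g : A' ⟶ B') :
    (f ⊗ₘ g).unop.hom = f.unop.hom.prodMap g.unop.hom := by
  have h : f ⊗ₘ g = lift (fst A A' ≫ f) (snd A A' ≫ g) := by
    apply CartesianMonoidalCategory.hom_ext <;> simp
  rw [h]
  exact coprod_inl_comp_inr_comp f.unop.hom g.unop.hom

theorem vecOp_inj₀ (A B : (ModuleCat.{u} F)ᵒᵖ) :
    (inj₀ A B).unop.hom = LinearMap.fst F A.unop B.unop := by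
  rw [inj₀, vecOp_lift]
  exact LinearMap.prod_ext (LinearMap.ext fun v => add_zero _) (LinearMap.ext fun v => zero_add _)

theorem vecOp_inj₁ (A B : (ModuleCat.{u} F)ᵒᵖ) :
    (inj₁ A B).unop.hom = LinearMap.snd F A.unop B.unop := by
  rw [inj₁, vecOp_lift]
  exact LinearMap.prod_ext (LinearMap.ext fun v => add_zero _) (LinearMap.ext fun v => zero_add _)

theorem vecOp_id_tensor {A B B' : (ModuleCat.{u} F)ᵒᵖ} (f : B ⟶ B') :
    (𝟙 A ⊗ₘ f).unop.hom = LinearMap.prodMap LinearMap.id f.unop.hom :=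
  vecOp_tensorHom _ _

theorem vecOp_liftingMap (A : (ModuleCat.{u} F)ᵒᵖ) : (liftingMap A).unop.hom =
    (LinearMap.fst F A.unop A.unop).prodMap (LinearMap.snd F A.unop A.unop) := by
  rw [liftingMap, vecOp_tensorHom, vecOp_inj₀, vecOp_inj₁]

theorem vecOp_interchangeMap_apply (A : (ModuleCat.{u} F)ᵒᵖ)
    (x : (A.unop × A.unop) × (A.unop × A.unop)) :
    ((interchangeMap A).unop.hom : ((A.unop × A.unop) × (A.unop × A.unop)) →ₗ[F]
      ((A.unop × A.unop) × (A.unop × A.unop))) x = ((x.1.1, x.2.1), (x.1.2, x.2.2)) := by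
  rw [interchangeMap, vecOp_lift, vecOp_tensorHom, vecOp_tensorHom]
  exact Prod.ext (Prod.ext (add_zero _) (zero_add _)) (Prod.ext (add_zero _) (zero_add _))

variable (F)

/-- The multiplication of the monad `Γ`. -/
def gamMu : gamFunctor F ⋙ gamFunctor F ⟶ gamFunctor F where
  app V := ModuleCat.ofHom (gamMul F V)
  naturality _ _ f := ModuleCat.hom_ext (gamMul_naturality f.hom).symm

theorem isMonad_gamMu : IsMonad (gamEta F) (gamMu F) where
  assoc V := ModuleCat.hom_ext (gamMul_assoc (V := V))
  left_unit V := ModuleCat.hom_ext (gamMul_left_unit (V := V))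
  right_unit V := ModuleCat.hom_ext (gamMul_right_unit (V := V))

-- Unfolding these to tensors makes unification at `Γ(Γ(V))` prohibitively slow.
attribute [local irreducible] gamLift gamMul gamMap gamUnit symTensors iterPrec letters gamDeriv
  gamCounit

/-- `∂_A`, as a map `!(A × A) ⟶ !A` of `F-VEC^op`. -/
def gamDerivOp (A : (ModuleCat.{u} F)ᵒᵖ) :
    (isMonad_gamMu F).opComonad.obj (A ⊗ A) ⟶ (isMonad_gamMu F).opComonad.obj A :=
  Quiver.Hom.op (X := ModuleCat.of F (Gam F A.unop))
    (Y := ModuleCat.of F (Gam F (A.unop × A.unop))) (ModuleCat.ofHom (gamDeriv F A.unop))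

/-- `ε_A`, as a map `A ⟶ !A` of `F-VEC^op`. -/
def gamCounitOp (A : (ModuleCat.{u} F)ᵒᵖ) : A ⟶ (isMonad_gamMu F).opComonad.obj A :=
  Quiver.Hom.op (X := ModuleCat.of F (Gam F A.unop)) (Y := A.unop)
    (ModuleCat.ofHom (gamCounit F A.unop))

/-- The differential combinator transformation on `Γ`. -/
def gamDifferential : DifferentialCombinatorTransformation (isMonad_gamMu F).opComonad where
  app := gamDerivOp F
  naturality {A B} f := Quiver.Hom.unop_inj (ModuleCat.hom_ext
    ((congrArg (fun g => gamMap g ∘ₗ gamDeriv F B.unop) (vecOp_tensorHom f f)).trans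
      (gamDeriv_naturality f.unop.hom).symm))
  zero_rule A := Quiver.Hom.unop_inj (ModuleCat.hom_ext
    ((congrArg (fun g => gamMap g ∘ₗ gamDeriv F A.unop) (vecOp_inj₀ A A)).trans
      (gamDeriv_zero_rule (V := A.unop))))
  additive_rule A := by
    refine Quiver.Hom.unop_inj (ModuleCat.hom_ext ?_)
    change gamMap (𝟙 A ⊗ₘ sumMap A).unop.hom ∘ₗ gamDeriv F A.unop =
      (gamMap (𝟙 A ⊗ₘ fst A A).unop.hom + gamMap (𝟙 A ⊗ₘ snd A A).unop.hom) ∘ₗ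
        gamDeriv F A.unop
    rw [vecOp_id_tensor, vecOp_id_tensor, vecOp_id_tensor]
    exact gamDeriv_additive_rule (V := A.unop) _ _ _
      (LinearMap.ext fun x => Prod.ext rfl (((LinearMap.inl F A.unop A.unop +
        LinearMap.inr F A.unop A.unop).map_zero).trans (LinearMap.inl F A.unop A.unop).map_zero.symm))
      (LinearMap.ext fun x => Prod.ext rfl (((LinearMap.inl F A.unop A.unop +
        LinearMap.inr F A.unop A.unop).map_zero).trans (LinearMap.inr F A.unop A.unop).map_zero.symm))
      (LinearMap.ext fun x => Prod.ext (add_zero _).symm rfl)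
  linear_rule A := Quiver.Hom.unop_inj (ModuleCat.hom_ext (gamDeriv_linear_rule (V := A.unop)))
  chain_rule A := Quiver.Hom.unop_inj (ModuleCat.hom_ext (gamDeriv_chain_rule (V := A.unop)))
  lift_rule A := Quiver.Hom.unop_inj (ModuleCat.hom_ext
    ((congrArg (fun g => gamMap g ∘ₗ gamDeriv F (A.unop × A.unop) ∘ₗ gamDeriv F A.unop)
      (vecOp_liftingMap A)).trans (gamDeriv_lift_rule (V := A.unop))))
  symmetry_rule A := Quiver.Hom.unop_inj (ModuleCat.hom_ext
    (gamDeriv_symmetry_rule (V := A.unop) _ (vecOp_interchangeMap_apply A)))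

/-- The `D`-linear unit of `Γ`. -/
def gamLinearUnit : DLinearUnit (gamDifferential F) where
  app := gamCounitOp F
  naturality f := Quiver.Hom.unop_inj (ModuleCat.hom_ext
    (gamCounit_naturality f.unop.hom).symm)
  linear_rule _ := Quiver.Hom.unop_inj (ModuleCat.hom_ext
    (LinearMap.ext fun v => gamCounit_gamUnit v))
  linearization_rule A := Quiver.Hom.unop_inj (ModuleCat.hom_ext
    ((gamCounit_linearization_rule (V := A.unop)).trans
      (congrArg (fun g => gamMap g ∘ₗ gamDeriv F A.unop) (vecOp_inj₁ A A).symm)))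

end VecOp

end

theorem corollary6p5 (F : Type u) [Field F] :
    -- the formulas on monomials extend uniquely to linear maps
    (∀ V : ModuleCat.{u} F,
      (∃! m : Gam F (Gam F V) →ₗ[F] Gam F V, IsGamMul m) ∧
      (∃! d : Gam F V →ₗ[F] Gam F (V × V), IsGamDeriv d) ∧
      (∃! e : Gam F V →ₗ[F] V, IsGamCounit e)) ∧
    -- they make `Γ` a monad, with a differential combinator transformation and a `D`-linear unit
    ∃ (μ : gamFunctor F ⋙ gamFunctor F ⟶ gamFunctor F) (hμ : IsMonad (gamEta F) μ)
      (d : DifferentialCombinatorTransformation hμ.opComonad) (e : DLinearUnit d),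
      (∀ V : ModuleCat.{u} F, IsGamMul (V := V) (μ.app V).hom) ∧
      (∀ V : ModuleCat.{u} F, IsGamDeriv (V := V) (d.app (Opposite.op V)).unop.hom) ∧
      (∀ V : ModuleCat.{u} F, IsGamCounit (V := V) (e.app (Opposite.op V)).unop.hom) ∧
      -- the coKleisli category is a Cartesian differential category, with `D[f] = f ∘ ∂`
      ∃ 𝔇 : DifferentialCombinator (Cokleisli hμ.opComonad),
        (∀ (A B : Cokleisli hμ.opComonad) (f : A ⟶ B), (𝔇.D f).of = d.app A.of ≫ f.of) ∧
        -- the canonical functor `f ↦ f ∘ ε` is an isomorphism of categories onto `D-lin`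
        ∃ (Φ : (ModuleCat.{u} F)ᵒᵖ ⥤ 𝔇.DLin) (Ψ : 𝔇.DLin ⥤ (ModuleCat.{u} F)ᵒᵖ),
          Φ ⋙ Ψ = 𝟭 _ ∧ Ψ ⋙ Φ = 𝟭 _ ∧
          Φ ⋙ wideSubcategoryInclusion 𝔇.IsLinear =
            Cokleisli.Adjunction.toCokleisli hμ.opComonad := by
  refine ⟨fun V => ⟨⟨gamMul F V, isGamMul_gamMul, fun m hm => hm.eq isGamMul_gamMul⟩,
      ⟨gamDeriv F V, isGamDeriv_gamDeriv, fun d hd => hd.eq isGamDeriv_gamDeriv⟩,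
      ⟨gamCounit F V, isGamCounit_gamCounit, fun e he => he.eq isGamCounit_gamCounit⟩⟩,
    gamMu F, isMonad_gamMu F, gamDifferential F, gamLinearUnit F,
    fun V => isGamMul_gamMul, fun V => isGamDeriv_gamDeriv, fun V => isGamCounit_gamCounit,
    cokleisliDifferential (gamDifferential F), fun _ _ _ => rfl,
    toDLin (gamDifferential F), fromDLin (gamLinearUnit F),
    toDLin_comp_fromDLin _, fromDLin_comp_toDLin _, rfl⟩
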